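/- There are universal constants $C,K>0$ such that the following holds for every $\epsilon_0\in(0,1]$, every $C_1>2400/\epsilon_0$ and all $n\ge N(\epsilon_0,C_1)$. **Model.** Let $\boldsymbol Y=\lambda^\star \boldsymbol u^\star\boldsymbol u^{\star\top}+\boldsymbol W\in\mathbb R^{n\times n}$ with $\lambda^\star\neq 0$ and $\|\boldsymbol u^\star\|_2=1$. Put $L=\log(2n)/\log\log n$ and $\mathcal A=\{(\log n)^{-k/2}: k=1,\dots,\lceil L\rceil-1\}\cup\{(\log n)^{-L/2}\}$. Assume: 1. $\boldsymbol W$ is a symmetric random matrix whose entries on and above the diagonal are independent and symmetric about zero, with common variance $\sigma^2$ and common subgaussian parameter $\nu$, that is, $\mathbb E e^{tW_{ij}}\le e^{\nu t^2/2}$ for all $t\in\mathbb R$. 2. There is $\alpha_0\in\mathcal A$ with $\frac1{\alpha_0^2}\ge|\{i:|u^\star_i|\ge\alpha_0\}|>\frac1{\alpha_0^2\log^2 n}$ and $\{i:|u^\star_i|\in[(1-\epsilon_0)\alpha_0,(1+\epsilon_0)\alpha_0]\}=\emptyset$. 3. $|\lambda^\star|\ge C_1\sqrt{\nu n\log n}$.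 **Estimator.** Let $\lambda_0$ be an input that either has the same sign as $\lambda^\star$ or is an eigenvalue of $\boldsymbol Y$ of largest absolute value. Put $s=-1$ if $\lambda_0<0$ and $s=1$ otherwise, let $\boldsymbol u$ be a unit eigenvector for the largest eigenvalue of $s\boldsymbol Y$, and, with $\beta=\epsilon_0/2$, pick any $\widehat\alpha\in\mathcal A$ such that $\hat I=\{i:|u_i|\ge\widehat\alpha\}$ satisfies $$|\hat I|\ge\frac1{\widehat\alpha^2\log^2 n},\qquad \{i:(1-\beta)\widehat\alpha<|u_i|<(1+\beta)\widehat\alpha\}=\emptyset .$$ Let $\boldsymbol Q$ be diagonal with $Q_{kk}=\operatorname{sgn}(u_k)$ for $k\in\hat I$ and $Q_{kk}=1$ otherwise, $\widetilde{\boldsymbol Y}=\boldsymbol Q(s\boldsymbol Y)\boldsymbol Q$, $\widehat S=\sqrt{\sum_{j,k\in\hat I}\widetilde Y_{jk}}$, and $$\widehat\lambda=s\cdot\frac{\sum_{j=1}^n\big(\sum_{k\in\hat I}\widetilde Y_{jk}\big)^2-|\hat I|\,n\,\sigma^2}{\widehat S^2}.$$ **Conclusion.** With probability at least $1-K n^{-8}\log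 n$, for all such $\lambda_0$ and $\boldsymbol u$, at least one admissible $\widehat\alpha$ exists, and for every admissible $\widehat\alpha$ the quantity $\widehat S$ is well defined and positive and $$|\widehat\lambda-\lambda^\star|\le C\sqrt{\nu}\,(\log n)^{5/2}.$$ -/

import Mathlib

open scoped Matrix NNReal

noncomputable section

namespace SpikedWigner

/-- Noise model: `W` is a symmetric random matrix whose entries on and above the diagonal are
independent and symmetric about zero, with common variance `σ ^ 2` and common subgaussian
parameter `ν`, i.e. `𝔼 exp (t * W i j) ≤ exp (ν * t ^ 2 / 2)` for all `t`. -/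
structure IsNoise {Ω : Type*} [MeasurableSpace Ω] (μ : MeasureTheory.Measure Ω) {n : ℕ}
    (W : Ω → Matrix (Fin n) (Fin n) ℝ) (σ : ℝ) (ν : ℝ≥0) : Prop where
  measurable : ∀ i j, Measurable fun ω => W ω i j
  isSymm : ∀ ω, (W ω).IsSymm
  indep : ProbabilityTheory.iIndepFun
    (fun (p : {p : Fin n × Fin n // p.1 ≤ p.2}) ω => W ω p.1.1 p.1.2) μ
  symmetric : ∀ i j, ProbabilityTheory.IdentDistrib (fun ω => W ω i j) (fun ω => -W ω i j) μ μ
  variance_eq : ∀ i j, ProbabilityTheory.variance (fun ω => W ω i j) μ = σ ^ 2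
  subgaussian : ∀ i j, ProbabilityTheory.HasSubgaussianMGF (fun ω => W ω i j) ν μ

/-- `L = log (2n) / log log n`. -/
def gridLength (n : ℕ) : ℝ := Real.log (2 * n) / Real.log (Real.log n)

/-- The grid `{(log n)^(-1/2), …, (log n)^(-(⌈L⌉ - 1)/2), (log n)^(-L/2)}`. -/
def grid (n : ℕ) : Set ℝ :=
  {α | ∃ k : ℕ, 1 ≤ k ∧ k + 1 ≤ ⌈gridLength n⌉₊ ∧ α = Real.log n ^ (-(k : ℝ) / 2)} ∪
    {Real.log n ^ (-gridLength n / 2)}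

/-- The set `{i : |v i| ≥ α}` of large entries of `v`. -/
def largeSet {n : ℕ} (v : Fin n → ℝ) (α : ℝ) : Finset (Fin n) :=
  Finset.univ.filter fun i => α ≤ |v i|

/-- The gap assumption on the signal vector, with gap constant `ε₀`. -/
def HasGap {n : ℕ} (ustar : Fin n → ℝ) (ε₀ : ℝ) : Prop :=
  ∃ α₀ ∈ grid n,
    ((largeSet ustar α₀).card : ℝ) ≤ 1 / α₀ ^ 2 ∧
    1 / (α₀ ^ 2 * Real.log n ^ 2) < ((largeSet ustar α₀).card : ℝ) ∧
    {i | |ustar i| ∈ Set.Icc ((1 - ε₀) * α₀) ((1 + ε₀) * α₀)} = (∅ : Set (Fin n))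

/-- `θ` is an eigenvalue of `Y` of largest absolute value. -/
def IsLeadingEigenvalue {n : ℕ} (Y : Matrix (Fin n) (Fin n) ℝ) (θ : ℝ) : Prop :=
  Module.End.HasEigenvalue (Matrix.toLin' Y) θ ∧
    ∀ θ', Module.End.HasEigenvalue (Matrix.toLin' Y) θ' → |θ'| ≤ |θ|

/-- `u` is a (Euclidean) unit eigenvector of `Y` for the largest eigenvalue of `Y`. -/
def IsTopEigenvector {n : ℕ} (Y : Matrix (Fin n) (Fin n) ℝ) (u : Fin n → ℝ) : Prop :=
  ∑ i, u i ^ 2 = 1 ∧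
    ∃ θ : ℝ, Y *ᵥ u = θ • u ∧ ∀ θ', Module.End.HasEigenvalue (Matrix.toLin' Y) θ' → θ' ≤ θ

/-- The sign by which the first step multiplies the data, given the input `lam₀`. -/
def orientation (lam₀ : ℝ) : ℝ := if lam₀ < 0 then -1 else 1

/-- `α` is an admissible choice of the threshold, given the eigenvector `u`. -/
def IsAdmissible {n : ℕ} (β : ℝ) (u : Fin n → ℝ) (α : ℝ) : Prop :=
  α ∈ grid n ∧
    1 / (α ^ 2 * Real.log n ^ 2) ≤ ((largeSet u α).card : ℝ) ∧
    {i | (1 - β) * α < |u i| ∧ |u i| < (1 + β) * α} = (∅ : Set (Fin n))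

/-- The diagonal matrix `Q` of signs of `u` on `Î = {i : |u i| ≥ α}` (and `1` off `Î`). -/
def signMatrix {n : ℕ} (u : Fin n → ℝ) (α : ℝ) : Matrix (Fin n) (Fin n) ℝ :=
  Matrix.diagonal fun k => if k ∈ largeSet u α then Real.sign (u k) else 1

/-- `Ỹ = Q Y Q`. -/
def yTilde {n : ℕ} (Y : Matrix (Fin n) (Fin n) ℝ) (u : Fin n → ℝ) (α : ℝ) :
    Matrix (Fin n) (Fin n) ℝ :=
  signMatrix u α * Y * signMatrix u α

/-- `Ŝ = √(∑_{j,k ∈ Î} Ỹ j k)`. -/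
def sHat {n : ℕ} (Y : Matrix (Fin n) (Fin n) ℝ) (u : Fin n → ℝ) (α : ℝ) : ℝ :=
  Real.sqrt (∑ j ∈ largeSet u α, ∑ k ∈ largeSet u α, yTilde Y u α j k)

/-- `(∑_j (∑_{k ∈ Î} Ỹ j k)² - |Î| n σ²) / Ŝ²`. -/
def lambdaHat {n : ℕ} (Y : Matrix (Fin n) (Fin n) ℝ) (σ : ℝ) (u : Fin n → ℝ) (α : ℝ) : ℝ :=
  ((∑ j, (∑ k ∈ largeSet u α, yTilde Y u α j k) ^ 2) -
      ((largeSet u α).card : ℝ) * (n : ℝ) * σ ^ 2) / sHat Y u α ^ 2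

/-- The good outcome for the data matrix `Y`: for every input `lam₀` of the algorithm that has
the sign of `lam` or is a leading eigenvalue of `Y`, and every top eigenvector `u` of the oriented
data, an admissible threshold exists, and every admissible threshold gives `Ŝ > 0` and an
eigenvalue estimate (with the orientation undone) within `r` of `lam`. -/
def GoodOutcome {n : ℕ} (Y : Matrix (Fin n) (Fin n) ℝ) (lam σ β r : ℝ) : Prop :=
  ∀ lam₀ : ℝ, (0 < lam₀ * lam ∨ IsLeadingEigenvalue Y lam₀) →
    ∀ u : Fin n → ℝ, IsTopEigenvector (orientation lam₀ • Y) u →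
      (∃ α, IsAdmissible β u α) ∧
      ∀ α, IsAdmissible β u α →
        0 < sHat (orientation lam₀ • Y) u α ∧
        |orientation lam₀ * lambdaHat (orientation lam₀ • Y) σ u α - lam| ≤ r

end SpikedWigner

end

/-! Once `u` is known to have the same large entries as the signal `v`, with the same signs up to
one global sign, the estimator is explicit. Let `q` be the sign vector of `v` on `Î`, `m = |Î|`, `a
= ⟨v, q⟩`, `l = |λ⋆|`, and let `A` be the oriented noise. The global sign cancels, so `Ŝ² = l a² +
qᵀAq`, and the numerator is `l² a² + 2 l a vᵀAq + (‖Aq‖² - m n σ²)`. Their ratio is `l` plus noise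
terms. Since `a ≥ m α`, the cardinality condition gives `m ≤ a² log² n`; this costs `log² n` in the
rate, and the subgaussian tails cost a further `√(log n)`.

Although `q` depends on the data, it does so only through the threshold, and every nonempty
threshold set of `v` has the form `{k : |v k| ≥ |v i|}` for some `i` (`exists_largeSet_eq`). A union
bound over at most `n` deterministic vectors therefore replaces independence.

Recovery of support and signs rests on an entrywise estimate for the top eigenvector
(`abs_eigenvector_entry_le`), proved by leaving one row and column out: row `i` of the noise is
independent of the compressed matrix, hence of the powers of that matrix applied to `v`. The error
is small relative to `|v i| + α`, so a gap of relative width `ε₀` in `v` survives in `u` with half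
the width, and a gap in `u` at any admissible threshold forces equal large sets.

The tails of linear forms, row products and off-diagonal chaos all come from one exponential
supermartingale, `lintegral_exp_predictable_le`; only the diagonal part of `‖Aq‖²` needs a separate
Bernstein bound. `TameNoise` is the interface: `TameNoise.goodOutcome` is purely deterministic, and
`IsNoise.measure_not_tame_of_pos` bounds the exceptional event. -/

noncomputable section

namespace SpikedWigner

open MeasureTheory ProbabilityTheory
open scoped ENNReal

/-! ### Exponential supermartingale for predictable linear forms. -/

section Predictable

variable {Ω : Type*} [MeasurableSpace Ω] {μ : Measure Ω} [IsProbabilityMeasure μ]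

/-- One supermartingale step: with `Z` frozen, the compensated exponential of `c (Z) X` has mean at
most one by subgaussianity. The weight `F` carries the factors already accumulated. -/
lemma lintegral_exp_mul_le {β : Type*} [MeasurableSpace β] {X : Ω → ℝ} {Z : Ω → β} {ν : ℝ≥0}
    (hX : Measurable X) (hZ : Measurable Z) (hind : IndepFun Z X μ)
    (hsub : HasSubgaussianMGF X ν μ) {c : β → ℝ} (hc : Measurable c) {F : β → ℝ≥0∞}
    (hF : Measurable F) :
    ∫⁻ ω, ENNReal.ofReal (Real.exp (c (Z ω) * X ω - ν * c (Z ω) ^ 2 / 2)) * F (Z ω) ∂μ ≤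
      ∫⁻ ω, F (Z ω) ∂μ := by
  have hmap := (indepFun_iff_map_prod_eq_prod_map_map hZ.aemeasurable hX.aemeasurable).1 hind
  have := Measure.isProbabilityMeasure_map (μ := μ) hX.aemeasurable
  have := Measure.isProbabilityMeasure_map (μ := μ) hZ.aemeasurable
  set g : β × ℝ → ℝ≥0∞ := fun p =>
    ENNReal.ofReal (Real.exp (c p.1 * p.2 - ν * c p.1 ^ 2 / 2)) * F p.1 with hg
  have hgm : Measurable g := by fun_prop
  have h1 : ∫⁻ ω, ENNReal.ofReal (Real.exp (c (Z ω) * X ω - ν * c (Z ω) ^ 2 / 2)) * F (Z ω) ∂μ =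
      ∫⁻ p, g p ∂(μ.map fun ω => (Z ω, X ω)) := by
    rw [lintegral_map hgm (hZ.prodMk hX)]
  rw [h1, hmap, lintegral_prod _ hgm.aemeasurable, ← lintegral_map hF hZ]
  refine lintegral_mono fun z => ?_
  simp only [hg]
  rw [lintegral_mul_const _ (by fun_prop), lintegral_map (by fun_prop) hX]
  have h2 : ∫⁻ ω, ENNReal.ofReal (Real.exp (c z * X ω - ν * c z ^ 2 / 2)) ∂μ ≤ 1 := by
    have hint := hsub.integrable_exp_mul (c z)
    have h3 : ∀ ω, Real.exp (c z * X ω - ν * c z ^ 2 / 2) =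
        Real.exp (c z * X ω) * Real.exp (-(ν * c z ^ 2 / 2)) := fun ω => by
      rw [← Real.exp_add]; ring_nf
    simp only [h3]
    rw [← ofReal_integral_eq_lintegral_ofReal (hint.mul_const _)
      (Filter.Eventually.of_forall fun ω => by positivity), integral_mul_const]
    rw [ENNReal.ofReal_le_one]
    have := hsub.mgf_le (c z)
    rw [mgf] at this
    calc _ ≤ Real.exp (ν * c z ^ 2 / 2) * Real.exp (-(ν * c z ^ 2 / 2)) := by gcongr
      _ = 1 := by rw [← Real.exp_add]; simp
  calc _ ≤ 1 * F z := by gcongr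
    _ = F z := one_mul _

variable {ι : Type*} [Fintype ι] [DecidableEq ι] {X : ι → Ω → ℝ} {ν : ℝ≥0}

/-- A predictable linear form in independent subgaussian variables has the exponential moment of
its bracket. -/
lemma lintegral_exp_predictable_le (hind : iIndepFun X μ) (hX : ∀ i, Measurable (X i))
    (hsub : ∀ i, HasSubgaussianMGF (X i) ν μ) (r : ι → ℕ) (c : ι → (ι → ℝ) → ℝ)
    (hc : ∀ i, Measurable (c i))
    (hpred : ∀ i a, r i ≤ r a → ∀ x t, c i (Function.update x a t) = c i x) (s : Finset ι) :
    ∫⁻ ω, ENNReal.ofReal (Real.exp (∑ i ∈ s, (c i (fun j => X j ω) * X i ω -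
      ν * c i (fun j => X j ω) ^ 2 / 2))) ∂μ ≤ 1 := by
  induction s using Finset.induction_on_max_value r with
  | empty => simp
  | insert a s ha hmax ih =>
    -- The index `a` has maximal rank, so no coefficient in play, including that of `a`, reads
    -- coordinate `a`. Setting it to zero changes none of them and makes them functions of a vector
    -- independent of `X a`.
    set Z : Ω → ι → ℝ := fun ω => Function.update (fun j => X j ω) a 0 with hZdef
    have hZ : Measurable Z := by
      refine measurable_pi_lambda _ fun j => ?_
      by_cases hj : j = a
      · subst hj; simp [hZdef]
      · simpa [hZdef, Function.update_of_ne hj] using hX j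
    have hindZ : IndepFun Z (X a) μ := by
      have h := hind.indepFun_finset (Finset.univ.erase a) {a} (by simp) hX
      have hψ : Measurable fun f : ↥({a} : Finset ι) → ℝ => f ⟨a, by simp⟩ :=
        measurable_pi_apply _
      have h' := h.comp (φ := fun (f : ↥(Finset.univ.erase a) → ℝ) (j : ι) =>
          if hj : j ∈ Finset.univ.erase a then f ⟨j, hj⟩ else 0)
        (ψ := fun (f : ↥({a} : Finset ι) → ℝ) => f ⟨a, by simp⟩)
        (by
          refine measurable_pi_lambda _ fun j => ?_
          split_ifs
          · exact measurable_pi_apply _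
          · exact measurable_const)
        hψ
      have hZeq : Z = (fun (f : ↥(Finset.univ.erase a) → ℝ) (j : ι) =>
          if hj : j ∈ Finset.univ.erase a then f ⟨j, hj⟩ else 0) ∘ fun ω i => X i ω := by
        funext ω j
        by_cases hj : j = a
        · subst hj; simp [hZdef]
        · simp [hZdef, hj]
      rw [hZeq]
      exact h'
    have hcZ : ∀ i, r i ≤ r a → ∀ ω, c i (fun j => X j ω) = c i (Z ω) := fun i hi ω =>
      (hpred i a hi _ _).symm
    set F : (ι → ℝ) → ℝ≥0∞ := fun z =>
      ENNReal.ofReal (Real.exp (∑ i ∈ s, (c i z * z i - ν * c i z ^ 2 / 2))) with hF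
    have hFm : Measurable F := by
      refine ENNReal.measurable_ofReal.comp (Real.measurable_exp.comp ?_)
      refine Finset.measurable_sum _ fun i _ => ?_
      have := hc i
      fun_prop
    have hsum : ∀ ω, ∑ i ∈ s, (c i (fun j => X j ω) * X i ω - ν * c i (fun j => X j ω) ^ 2 / 2) =
        ∑ i ∈ s, (c i (Z ω) * Z ω i - ν * c i (Z ω) ^ 2 / 2) := fun ω => by
      refine Finset.sum_congr rfl fun i hi => ?_
      have hne : i ≠ a := fun h => ha (h ▸ hi)
      rw [hcZ i (hmax i hi)]
      simp [hZdef, hne]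
    calc _ = ∫⁻ ω, ENNReal.ofReal (Real.exp (c a (Z ω) * X a ω - ν * c a (Z ω) ^ 2 / 2)) *
          F (Z ω) ∂μ := by
          refine lintegral_congr fun ω => ?_
          rw [Finset.sum_insert ha, Real.exp_add, ENNReal.ofReal_mul (Real.exp_pos _).le,
            hsum, hcZ a le_rfl]
      _ ≤ ∫⁻ ω, F (Z ω) ∂μ := lintegral_exp_mul_le (hX a) hZ hindZ (hsub a) (hc a) hFm
      _ ≤ 1 := by simpa only [hF, ← hsum] using ih

/-- Freedman-type bound: Chernoff's inequality restricted to the event that the bracket is at most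
`V`. -/
lemma measure_predictable_ge_le (hind : iIndepFun X μ) (hX : ∀ i, Measurable (X i))
    (hsub : ∀ i, HasSubgaussianMGF (X i) ν μ) (r : ι → ℕ) (c : ι → (ι → ℝ) → ℝ)
    (hc : ∀ i, Measurable (c i))
    (hpred : ∀ i a, r i ≤ r a → ∀ x t, c i (Function.update x a t) = c i x)
    (hν : 0 < ν) {t V : ℝ} (ht : 0 ≤ t) (hV : 0 < V) :
    μ {ω | t ≤ ∑ i, c i (fun j => X j ω) * X i ω ∧ ∑ i, c i (fun j => X j ω) ^ 2 ≤ V} ≤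
      ENNReal.ofReal (Real.exp (-(t ^ 2 / (2 * ν * V)))) := by
  have hν' : (0 : ℝ) < ν := hν
  -- The maximiser of `s t - ν s² V / 2`.
  set s : ℝ := t / (ν * V) with hs
  have hs0 : 0 ≤ s := by positivity
  have key := lintegral_exp_predictable_le hind hX hsub r (fun i x => s * c i x)
    (fun i => (hc i).const_mul s) (fun i a h x t => by rw [hpred i a h]) Finset.univ
  have hmeas : Measurable fun ω => ENNReal.ofReal (Real.exp (∑ i, (s * c i (fun j => X j ω) * X i ω -
      ν * (s * c i (fun j => X j ω)) ^ 2 / 2))) := by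
    refine ENNReal.measurable_ofReal.comp (Real.measurable_exp.comp ?_)
    refine Finset.measurable_sum _ fun i _ => ?_
    have h1 : Measurable fun ω => c i (fun j => X j ω) :=
      (hc i).comp (measurable_pi_lambda _ hX)
    have := hX i
    fun_prop
  have hexp : t ^ 2 / (2 * ν * V) = s * t - ν * s ^ 2 * V / 2 := by
    rw [hs]; field_simp; ring
  have hsub' : {ω | t ≤ ∑ i, c i (fun j => X j ω) * X i ω ∧ ∑ i, c i (fun j => X j ω) ^ 2 ≤ V} ⊆
      {ω | ENNReal.ofReal (Real.exp (t ^ 2 / (2 * ν * V))) ≤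
        ENNReal.ofReal (Real.exp (∑ i, (s * c i (fun j => X j ω) * X i ω -
          ν * (s * c i (fun j => X j ω)) ^ 2 / 2)))} := by
    rintro ω ⟨h1, h2⟩
    refine ENNReal.ofReal_le_ofReal (Real.exp_le_exp.2 ?_)
    have : ∑ i, (s * c i (fun j => X j ω) * X i ω - ν * (s * c i (fun j => X j ω)) ^ 2 / 2) =
        s * (∑ i, c i (fun j => X j ω) * X i ω) -
          ν * s ^ 2 * (∑ i, c i (fun j => X j ω) ^ 2) / 2 := by
      rw [Finset.sum_sub_distrib, Finset.mul_sum, Finset.mul_sum, Finset.sum_div]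
      congr 1 <;> refine Finset.sum_congr rfl fun i _ => by ring
    rw [this, hexp]
    gcongr
  refine (measure_mono hsub').trans ?_
  refine (meas_ge_le_lintegral_div hmeas.aemeasurable (by simp [Real.exp_pos])
    ENNReal.ofReal_ne_top).trans ?_
  rw [Real.exp_neg, ENNReal.ofReal_inv_of_pos (Real.exp_pos _), ENNReal.div_eq_inv_mul]
  calc _ ≤ (ENNReal.ofReal (Real.exp (t ^ 2 / (2 * ν * V))))⁻¹ * 1 := by gcongr
    _ = _ := mul_one _

end Predictable

/-! ### Linear forms in the entries of a symmetric noise matrix. -/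

section MatrixForms

variable {n : ℕ}

/-- The symmetric matrix with prescribed entries on and above the diagonal. -/
def symMat (x : {p : Fin n × Fin n // p.1 ≤ p.2} → ℝ) : Matrix (Fin n) (Fin n) ℝ := fun a b =>
  if h : a ≤ b then x ⟨(a, b), h⟩ else x ⟨(b, a), (not_le.1 h).le⟩

lemma symMat_entries {A : Matrix (Fin n) (Fin n) ℝ} (hA : A.IsSymm) :
    symMat (fun p => A p.1.1 p.1.2) = A := by
  ext a b
  unfold symMat
  split_ifs
  · rfl
  · exact hA.apply a b

/-- Folds a form in all entries onto the upper triangle, where the entries are independent. -/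
lemma sum_upper_eq (H : Fin n → Fin n → ℝ) :
    ∑ p : {p : Fin n × Fin n // p.1 ≤ p.2},
      (if p.1.1 = p.1.2 then H p.1.1 p.1.1 else H p.1.1 p.1.2 + H p.1.2 p.1.1) =
    ∑ j, ∑ k, H j k := by
  rw [← Finset.sum_subtype (Finset.univ.filter fun p : Fin n × Fin n => p.1 ≤ p.2) (by simp)
    (fun p : Fin n × Fin n => if p.1 = p.2 then H p.1 p.1 else H p.1 p.2 + H p.2 p.1),
    Finset.sum_filter, Fintype.sum_prod_type]
  have h : ∀ a b : Fin n, (if a ≤ b then (if a = b then H a a else H a b + H b a) else 0) =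
      (if a ≤ b then H a b else 0) + (if a < b then H b a else 0) := fun a b => by
    rcases lt_trichotomy a b with h | h | h
    · simp [h, h.le, h.ne]
    · simp [h]
    · simp [h.not_ge, h.le]
  simp only [h, Finset.sum_add_distrib]
  rw [Finset.sum_comm (f := fun a b => if a < b then H b a else 0), ← Finset.sum_add_distrib]
  refine Finset.sum_congr rfl fun a _ => ?_
  rw [← Finset.sum_add_distrib]
  refine Finset.sum_congr rfl fun b _ => ?_
  rcases le_or_gt a b with h | h
  · simp [h, h.not_gt]
  · simp [h, h.not_ge]

variable {Ω : Type*} [MeasurableSpace Ω] {μ : Measure Ω} [IsProbabilityMeasure μ]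
  {W : Ω → Matrix (Fin n) (Fin n) ℝ} {σ : ℝ} {ν : ℝ≥0}

/-- The symmetric rank `r` orders the entries, and a coefficient may read only entries of strictly
smaller rank. Folding onto the upper triangle at most doubles the bracket, as `(x + y)² ≤ 2 (x² +
y²)`; hence `4` in place of `2` in the exponent. -/
lemma IsNoise.measure_predictable_ge_le (hW : IsNoise μ W σ ν) (hν : 0 < ν)
    (G : Matrix (Fin n) (Fin n) ℝ → Matrix (Fin n) (Fin n) ℝ)
    (hG : ∀ j k, Measurable fun A : Fin n → Fin n → ℝ => G A j k)
    (r : Fin n → Fin n → ℕ) (hr : ∀ a b, r a b = r b a)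
    (hpred : ∀ j k A B, (∀ a b, r a b < r j k → A a b = B a b) → G A j k = G B j k)
    {t V : ℝ} (ht : 0 ≤ t) (hV : 0 < V) :
    μ {ω | t ≤ ∑ j, ∑ k, G (W ω) j k * W ω j k ∧ ∑ j, ∑ k, G (W ω) j k ^ 2 ≤ V} ≤
      ENNReal.ofReal (Real.exp (-(t ^ 2 / (4 * ν * V)))) := by
  set c : {p : Fin n × Fin n // p.1 ≤ p.2} → ({p : Fin n × Fin n // p.1 ≤ p.2} → ℝ) → ℝ :=
    fun p x => if p.1.1 = p.1.2 then G (symMat x) p.1.1 p.1.1 else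
      G (symMat x) p.1.1 p.1.2 + G (symMat x) p.1.2 p.1.1 with hc
  have hsymM : Measurable fun x : {p : Fin n × Fin n // p.1 ≤ p.2} → ℝ =>
      fun a b => symMat x a b := by
    refine measurable_pi_lambda _ fun a => measurable_pi_lambda _ fun b => ?_
    unfold symMat
    split_ifs <;> exact measurable_pi_apply _
  have hGM : ∀ j k, Measurable fun x => G (symMat x) j k := fun j k => (hG j k).comp hsymM
  have hupd : ∀ j k (a : {p : Fin n × Fin n // p.1 ≤ p.2}), r j k ≤ r a.1.1 a.1.2 →
      ∀ x t, G (symMat (Function.update x a t)) j k = G (symMat x) j k := by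
    intro j k a hra x t
    refine hpred j k _ _ fun a' b' hlt => ?_
    unfold symMat
    split_ifs with h
    · rw [Function.update_of_ne]
      rintro rfl
      exact absurd hlt (not_lt.2 hra)
    · rw [Function.update_of_ne]
      rintro rfl
      rw [hr] at hlt
      exact absurd hlt (not_lt.2 hra)
  have key := SpikedWigner.measure_predictable_ge_le (μ := μ) hW.indep
    (fun p => hW.measurable _ _) (fun p => hW.subgaussian _ _) (fun p => r p.1.1 p.1.2) c
    (fun p => by
      simp only [hc]
      split_ifs
      · exact hGM _ _
      · exact (hGM _ _).add (hGM _ _))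
    (fun p a h x t => by
      simp only [hc]
      split_ifs with heq
      · rw [hupd]
        rwa [← heq] at h
      · rw [hupd _ _ a h, hupd _ _ a (by rwa [hr] at h)]) hν ht (mul_pos two_pos hV)
  refine (measure_mono ?_).trans (key.trans (le_of_eq ?_))
  · rintro ω ⟨h1, h2⟩
    have hWω : symMat (fun p : {p : Fin n × Fin n // p.1 ≤ p.2} => W ω p.1.1 p.1.2) = W ω :=
      symMat_entries (hW.isSymm ω)
    simp only [Set.mem_ofPred_eq, hc, hWω]
    constructor
    · rw [← sum_upper_eq] at h1
      refine h1.trans (le_of_eq (Finset.sum_congr rfl fun p _ => ?_))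
      split_ifs with heq
      · rw [← heq]
      · rw [(hW.isSymm ω).apply p.1.1 p.1.2]; ring
    · rw [← sum_upper_eq] at h2
      refine le_trans ?_ (mul_le_mul_of_nonneg_left h2 zero_le_two)
      rw [Finset.mul_sum]
      refine Finset.sum_le_sum fun p _ => ?_
      split_ifs with heq
      · nlinarith [sq_nonneg (G (W ω) p.1.1 p.1.1)]
      · nlinarith [sq_nonneg (G (W ω) p.1.1 p.1.2 - G (W ω) p.1.2 p.1.1)]
  · congr 3
    ring

lemma IsNoise.measure_predictable_abs_ge_le (hW : IsNoise μ W σ ν) (hν : 0 < ν)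
    (G : Matrix (Fin n) (Fin n) ℝ → Matrix (Fin n) (Fin n) ℝ)
    (hG : ∀ j k, Measurable fun A : Fin n → Fin n → ℝ => G A j k)
    (r : Fin n → Fin n → ℕ) (hr : ∀ a b, r a b = r b a)
    (hpred : ∀ j k A B, (∀ a b, r a b < r j k → A a b = B a b) → G A j k = G B j k)
    {t V : ℝ} (ht : 0 ≤ t) (hV : 0 < V) :
    μ {ω | t ≤ |∑ j, ∑ k, G (W ω) j k * W ω j k| ∧ ∑ j, ∑ k, G (W ω) j k ^ 2 ≤ V} ≤
      ENNReal.ofReal (2 * Real.exp (-(t ^ 2 / (4 * ν * V)))) := by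
  have h1 := hW.measure_predictable_ge_le hν G hG r hr hpred ht hV
  have h2 := hW.measure_predictable_ge_le hν (fun A => -G A) (fun j k => (hG j k).neg) r hr
    (fun j k A B h => by simp [hpred j k A B h]) ht hV
  rw [two_mul, ENNReal.ofReal_add (Real.exp_pos _).le (Real.exp_pos _).le]
  refine le_trans (measure_mono ?_) ((measure_union_le _ _).trans (add_le_add h1 h2))
  rintro ω ⟨h, hv⟩
  rcases le_abs.1 h with h | h
  · exact Or.inl ⟨h, hv⟩
  · refine Or.inr ⟨?_, by simpa using hv⟩
    simpa [Finset.sum_neg_distrib] using h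

/-- Tail bound for a deterministic linear form. -/
lemma IsNoise.measure_linear_abs_ge_le (hW : IsNoise μ W σ ν) (hν : 0 < ν)
    (G : Matrix (Fin n) (Fin n) ℝ) {t V : ℝ} (ht : 0 ≤ t) (hV : 0 < V)
    (hGV : ∑ j, ∑ k, G j k ^ 2 ≤ V) :
    μ {ω | t ≤ |∑ j, ∑ k, G j k * W ω j k|} ≤
      ENNReal.ofReal (2 * Real.exp (-(t ^ 2 / (4 * ν * V)))) := by
  refine le_trans (measure_mono fun ω hω => ?_) (hW.measure_predictable_abs_ge_le hν (fun _ => G)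
    (fun j k => measurable_const) (fun _ _ => 0) (fun _ _ => rfl) (fun _ _ _ _ _ => rfl) ht hV)
  exact ⟨hω, hGV⟩

end MatrixForms

/-! ### Nets and the operator norm of the noise. -/

section Euclidean

variable {n : ℕ}

/-- The Euclidean norm of a vector. -/
def nrm (x : Fin n → ℝ) : ℝ := ‖(WithLp.toLp 2 x : EuclideanSpace ℝ (Fin n))‖

lemma nrm_nonneg (x : Fin n → ℝ) : 0 ≤ nrm x := norm_nonneg _

lemma nrm_add_le (x y : Fin n → ℝ) : nrm (x + y) ≤ nrm x + nrm y := by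
  unfold nrm; rw [WithLp.toLp_add]; exact norm_add_le _ _

lemma nrm_sub_le (x y : Fin n → ℝ) : nrm (x - y) ≤ nrm x + nrm y := by
  unfold nrm; rw [WithLp.toLp_sub]; exact norm_sub_le _ _

lemma nrm_smul (a : ℝ) (x : Fin n → ℝ) : nrm (a • x) = |a| * nrm x := by
  unfold nrm; rw [WithLp.toLp_smul, norm_smul, Real.norm_eq_abs]

lemma nrm_sq (x : Fin n → ℝ) : nrm x ^ 2 = ∑ i, x i ^ 2 := by
  unfold nrm; rw [EuclideanSpace.norm_sq_eq]; simp

lemma nrm_eq_one {x : Fin n → ℝ} (hx : ∑ i, x i ^ 2 = 1) : nrm x = 1 := by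
  rw [← nrm_sq] at hx
  nlinarith [nrm_nonneg x]

lemma abs_dotProduct_le (x y : Fin n → ℝ) : |x ⬝ᵥ y| ≤ nrm x * nrm y := by
  have h := abs_real_inner_le_norm (WithLp.toLp 2 y : EuclideanSpace ℝ (Fin n)) (WithLp.toLp 2 x)
  rw [EuclideanSpace.inner_eq_star_dotProduct] at h
  simpa [nrm, mul_comm] using h

lemma dotProduct_self_eq (x : Fin n → ℝ) : x ⬝ᵥ x = nrm x ^ 2 := by
  rw [nrm_sq]; simp [dotProduct, sq]

lemma abs_apply_le (x : Fin n → ℝ) (i : Fin n) : |x i| ≤ nrm x := by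
  have := PiLp.norm_apply_le (WithLp.toLp 2 x : EuclideanSpace ℝ (Fin n)) i
  simpa [nrm] using this

lemma nrm_single (i : Fin n) (a : ℝ) : nrm (Pi.single i a) = |a| := by
  have h : nrm (Pi.single i a) ^ 2 = |a| ^ 2 := by
    rw [nrm_sq, Finset.sum_eq_single i] <;> simp +contextual
  exact (sq_eq_sq₀ (nrm_nonneg _) (abs_nonneg _)).1 h

lemma nrm_eq_zero {x : Fin n → ℝ} : nrm x = 0 ↔ x = 0 := by
  unfold nrm; rw [norm_eq_zero]; simp

/-- `M` bounds the operator norm of `W`. -/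
def OpBound (W : Matrix (Fin n) (Fin n) ℝ) (M : ℝ) : Prop := ∀ x, nrm (W *ᵥ x) ≤ M * nrm x

/-- A 1-separated subset of the ball of radius 2 has at most `5 ^ n` points. One of greatest
cardinality is a 1-net by maximality; halving it gives the claim. -/
lemma exists_half_net (n : ℕ) : ∃ S : Finset (Fin n → ℝ), S.card ≤ 5 ^ n ∧
    (∀ x ∈ S, nrm x ≤ 1) ∧ ∀ x, nrm x ≤ 1 → ∃ y ∈ S, nrm (x - y) ≤ 1 / 2 := by
  classical
  set P : Finset (EuclideanSpace ℝ (Fin n)) → Prop := fun s =>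
    (∀ c ∈ s, ‖c‖ ≤ 2) ∧ ∀ c ∈ s, ∀ d ∈ s, c ≠ d → 1 ≤ ‖c - d‖ with hP
  have hcard : ∀ s, P s → s.card ≤ 5 ^ n := fun s hs => by
    simpa using Besicovitch.card_le_of_separated s hs.1 hs.2
  obtain ⟨s, hs, hsk⟩ := Nat.findGreatest_spec (P := fun k => ∃ s, P s ∧ s.card = k)
    (Nat.zero_le (5 ^ n)) ⟨∅, by simp [hP], rfl⟩
  have hmax : ∀ x : EuclideanSpace ℝ (Fin n), ‖x‖ ≤ 2 → ∃ y ∈ s, ‖x - y‖ < 1 := by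
    intro x hx
    by_contra! hcon
    have hxs : x ∉ s := fun h => absurd (hcon x h) (by simp)
    have hP' : P (insert x s) := by
      refine ⟨fun c hc => ?_, fun c hc d hd hcd => ?_⟩
      · rcases Finset.mem_insert.1 hc with rfl | hc
        · exact hx
        · exact hs.1 c hc
      · rcases Finset.mem_insert.1 hc with hc' | hc' <;>
          rcases Finset.mem_insert.1 hd with hd' | hd'
        · exact absurd (hc'.trans hd'.symm) hcd
        · rw [hc']; exact hcon d hd'
        · rw [hd', norm_sub_rev]; exact hcon c hc'
        · exact hs.2 c hc' d hd' hcd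
    have h2 := Nat.le_findGreatest (P := fun k => ∃ s, P s ∧ s.card = k) (hcard _ hP')
      ⟨_, hP', rfl⟩
    rw [Finset.card_insert_of_notMem hxs] at h2
    omega
  refine ⟨s.image fun x => (1 / 2 : ℝ) • x.ofLp, Finset.card_image_le.trans (hcard s hs), ?_, ?_⟩
  · intro x hx
    obtain ⟨y, hy, rfl⟩ := Finset.mem_image.1 hx
    rw [nrm_smul]
    have h1 := hs.1 y hy
    have h2 : nrm y.ofLp = ‖y‖ := rfl
    rw [h2, abs_of_pos (by norm_num)]
    linarith
  · intro x hx
    obtain ⟨y, hy, hxy⟩ := hmax (WithLp.toLp 2 ((2 : ℝ) • x)) (by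
      have : ‖(WithLp.toLp 2 ((2 : ℝ) • x) : EuclideanSpace ℝ (Fin n))‖ = nrm ((2 : ℝ) • x) := rfl
      rw [this, nrm_smul, abs_of_pos (by norm_num)]
      linarith)
    refine ⟨_, Finset.mem_image_of_mem _ hy, ?_⟩
    have h1 : x - (1 / 2 : ℝ) • y.ofLp = (1 / 2 : ℝ) • ((2 : ℝ) • x - y.ofLp) := by
      rw [smul_sub, smul_smul]; norm_num
    have h2 : nrm ((2 : ℝ) • x - y.ofLp) < 1 := hxy
    rw [h1, nrm_smul, abs_of_pos (by norm_num)]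
    linarith

/-- Each of the two arguments of the bilinear form costs a factor 2: approximating the direction of
`W y` by the net gives `‖W y‖ ≤ 2 t` on the net, and then `‖W‖ ≤ 2 t + ‖W‖ / 2`. -/
lemma opBound_of_half_net {S : Finset (Fin n → ℝ)}
    (hS : ∀ x, nrm x ≤ 1 → ∃ y ∈ S, nrm (x - y) ≤ 1 / 2) {W : Matrix (Fin n) (Fin n) ℝ} {t : ℝ}
    (ht : ∀ x ∈ S, ∀ y ∈ S, |x ⬝ᵥ (W *ᵥ y)| ≤ t) : OpBound W (4 * t) := by
  set T := LinearMap.toContinuousLinearMap (Matrix.toEuclideanLin W) with hT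
  have hTx : ∀ x, nrm (W *ᵥ x) = ‖T (WithLp.toLp 2 x)‖ := fun x => rfl
  have hle : ∀ x, nrm (W *ᵥ x) ≤ ‖T‖ * nrm x := fun x => by
    rw [hTx]; exact T.le_opNorm _
  obtain ⟨y0, hy0, -⟩ := hS 0 (by simp [nrm_eq_zero.2])
  have ht0 : 0 ≤ t := (abs_nonneg _).trans (ht y0 hy0 y0 hy0)
  have hnet : ∀ y ∈ S, nrm (W *ᵥ y) ≤ 2 * t := by
    intro y hy
    by_cases h0 : nrm (W *ᵥ y) = 0
    · rw [h0]; positivity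
    have hpos : 0 < nrm (W *ᵥ y) := lt_of_le_of_ne (nrm_nonneg _) (Ne.symm h0)
    set z := (nrm (W *ᵥ y))⁻¹ • (W *ᵥ y) with hz
    have hz1 : nrm z = 1 := by
      rw [hz, nrm_smul, abs_of_pos (inv_pos.2 hpos), inv_mul_cancel₀ h0]
    obtain ⟨x, hx, hxz⟩ := hS z hz1.le
    have h1 : z ⬝ᵥ (W *ᵥ y) = nrm (W *ᵥ y) := by
      rw [hz, smul_dotProduct, dotProduct_self_eq, smul_eq_mul]
      field_simp
    have h2 : z ⬝ᵥ (W *ᵥ y) = x ⬝ᵥ (W *ᵥ y) + (z - x) ⬝ᵥ (W *ᵥ y) := by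
      rw [sub_dotProduct]; ring
    have h3 := (le_abs_self _).trans (ht x hx y hy)
    have h4 := (le_abs_self _).trans (abs_dotProduct_le (z - x) (W *ᵥ y))
    have h5 : nrm (z - x) * nrm (W *ᵥ y) ≤ 1 / 2 * nrm (W *ᵥ y) := by gcongr
    linarith
  have hunit : ∀ x, nrm x ≤ 1 → nrm (W *ᵥ x) ≤ 2 * t + ‖T‖ / 2 := by
    intro x hx
    obtain ⟨y, hy, hxy⟩ := hS x hx
    have h1 : W *ᵥ x = W *ᵥ y + W *ᵥ (x - y) := by rw [← Matrix.mulVec_add]; simp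
    rw [h1]
    refine (nrm_add_le _ _).trans ?_
    have h2 := hle (x - y)
    have h3 : ‖T‖ * nrm (x - y) ≤ ‖T‖ * (1 / 2) := by gcongr
    linarith [hnet y hy]
  have hnorm : ‖T‖ ≤ 2 * t + ‖T‖ / 2 := by
    refine T.opNorm_le_bound (by positivity) fun x => ?_
    by_cases h0 : ‖x‖ = 0
    · rw [norm_eq_zero] at h0; simp [h0]
    have hpos : 0 < ‖x‖ := lt_of_le_of_ne (norm_nonneg _) (Ne.symm h0)
    have h1 := hunit (‖x‖⁻¹ • x.ofLp) (by
      rw [nrm_smul, abs_of_pos (inv_pos.2 hpos)]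
      exact (inv_mul_cancel₀ h0).le)
    rw [Matrix.mulVec_smul, nrm_smul, abs_of_pos (inv_pos.2 hpos), hTx,
      inv_mul_le_iff₀ hpos] at h1
    rw [mul_comm]
    exact h1
  intro x
  refine (hle x).trans ?_
  have := nrm_nonneg x
  gcongr
  linarith

variable {Ω : Type*} [MeasurableSpace Ω] {μ : Measure Ω} [IsProbabilityMeasure μ]
  {W : Ω → Matrix (Fin n) (Fin n) ℝ} {σ : ℝ} {ν : ℝ≥0}

lemma dotProduct_mulVec_eq_sum (x y : Fin n → ℝ) (A : Matrix (Fin n) (Fin n) ℝ) :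
    x ⬝ᵥ (A *ᵥ y) = ∑ j, ∑ k, (x j * y k) * A j k := by
  simp only [dotProduct, Matrix.mulVec, Finset.mul_sum]
  refine Finset.sum_congr rfl fun j _ => Finset.sum_congr rfl fun k _ => by ring

lemma sum_sum_mul_sq (x y : Fin n → ℝ) :
    ∑ j, ∑ k, (x j * y k) ^ 2 = nrm x ^ 2 * nrm y ^ 2 := by
  rw [nrm_sq, nrm_sq, Finset.sum_mul_sum]
  simp only [mul_pow]

/-- Tail bound for a deterministic bilinear form. -/
lemma IsNoise.measure_bilin_abs_ge_le (hW : IsNoise μ W σ ν) (hν : 0 < ν)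
    (x y : Fin n → ℝ) {t V : ℝ} (ht : 0 ≤ t) (hV : 0 < V) (hxy : nrm x ^ 2 * nrm y ^ 2 ≤ V) :
    μ {ω | t ≤ |x ⬝ᵥ (W ω *ᵥ y)|} ≤
      ENNReal.ofReal (2 * Real.exp (-(t ^ 2 / (4 * ν * V)))) := by
  simp only [dotProduct_mulVec_eq_sum]
  exact hW.measure_linear_abs_ge_le hν (Matrix.of fun j k => x j * y k) ht hV
    (by simpa [sum_sum_mul_sq] using hxy)

/-- Union bound over at most `25 ^ n ≤ exp (13 n / 4)` pairs of net points, each failing with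
probability at most `2 exp (-25 n / 4)`. -/
lemma IsNoise.measure_not_opBound_le (hW : IsNoise μ W σ ν) (hν : 0 < ν) :
    μ {ω | ¬ OpBound (W ω) (20 * Real.sqrt (ν * n))} ≤
      ENNReal.ofReal (2 * Real.exp (-3 * n)) := by
  obtain ⟨S, hcard, hS1, hS⟩ := exists_half_net n
  have hν' : (0 : ℝ) < ν := hν
  set t := 5 * Real.sqrt (ν * n) with ht
  have hsub : {ω | ¬ OpBound (W ω) (20 * Real.sqrt (ν * n))} ⊆
      ⋃ p ∈ S ×ˢ S, {ω | t ≤ |p.1 ⬝ᵥ (W ω *ᵥ p.2)|} := by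
    intro ω hω
    by_contra hcon
    refine hω ?_
    have h20 : 20 * Real.sqrt (ν * n) = 4 * t := by rw [ht]; ring
    rw [h20]
    refine opBound_of_half_net hS fun x hx y hy => ?_
    by_contra! hlt
    exact hcon (Set.mem_biUnion (x := (x, y)) (Finset.mk_mem_product hx hy) hlt.le)
  refine (measure_mono hsub).trans ((measure_biUnion_finset_le _ _).trans ?_)
  have hexp : t ^ 2 / (4 * ν * 1) = 25 / 4 * n := by
    rw [ht, mul_pow, Real.sq_sqrt (by positivity)]; field_simp; ring
  have h1 : ∀ p ∈ S ×ˢ S, μ {ω | t ≤ |p.1 ⬝ᵥ (W ω *ᵥ p.2)|} ≤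
      ENNReal.ofReal (2 * Real.exp (-(25 / 4 * n))) := by
    intro p hp
    obtain ⟨hp1, hp2⟩ := Finset.mem_product.1 hp
    rw [← hexp]
    refine hW.measure_bilin_abs_ge_le hν p.1 p.2 (by positivity) one_pos ?_
    exact mul_le_one₀ (pow_le_one₀ (nrm_nonneg _) (hS1 _ hp1)) (by positivity)
      (pow_le_one₀ (nrm_nonneg _) (hS1 _ hp2))
  refine (Finset.sum_le_sum h1).trans ?_
  rw [Finset.sum_const, nsmul_eq_mul, Finset.card_product,
    ← ENNReal.ofReal_natCast, ← ENNReal.ofReal_mul (by positivity)]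
  refine ENNReal.ofReal_le_ofReal ?_
  have h25 : (25 : ℝ) ≤ Real.exp (13 / 4) := by
    have h := Real.exp_one_gt_d9
    have h3 : Real.exp (13 / 4) = Real.exp 1 ^ 3 * Real.exp (1 / 4) := by
      rw [← Real.exp_nat_mul, ← Real.exp_add]; norm_num
    have h4 := Real.add_one_le_exp (1 / 4 : ℝ)
    have h5 : (2.718 : ℝ) ^ 3 ≤ Real.exp 1 ^ 3 := by gcongr; linarith
    rw [h3]
    nlinarith
  calc ((S.card * S.card : ℕ) : ℝ) * (2 * Real.exp (-(25 / 4 * n)))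
      ≤ ((5 ^ n * 5 ^ n : ℕ) : ℝ) * (2 * Real.exp (-(25 / 4 * n))) := by gcongr
    _ = 2 * (25 ^ n * Real.exp (-(25 / 4 * n))) := by
        push_cast; rw [← mul_pow]; norm_num; ring
    _ ≤ 2 * (Real.exp (13 / 4) ^ n * Real.exp (-(25 / 4 * n))) := by gcongr
    _ = 2 * Real.exp (-3 * n) := by
        rw [← Real.exp_nat_mul, ← Real.exp_add]; ring_nf

end Euclidean

/-! ### Leading eigenvalues of a rank-one perturbation. -/

section Spectral

variable {n : ℕ}

lemma hasEigenvalue_toLin'_iff {Y : Matrix (Fin n) (Fin n) ℝ} {θ : ℝ} :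
    Module.End.HasEigenvalue (Matrix.toLin' Y) θ ↔ ∃ w : Fin n → ℝ, w ≠ 0 ∧ Y *ᵥ w = θ • w := by
  constructor
  · intro h
    obtain ⟨w, hw⟩ := h.exists_hasEigenvector
    exact ⟨w, hw.2, by simpa using hw.apply_eq_smul⟩
  · rintro ⟨w, hw0, hw⟩
    exact Module.End.hasEigenvalue_of_hasEigenvector (x := w)
      ⟨Module.End.mem_eigenspace_iff.2 (by simpa using hw), hw0⟩

/-- Equivalently, `θ - Y` is positive semidefinite because its eigenvalues are nonnegative. -/
lemma dotProduct_mulVec_le_of_eigenvalues_le {Y : Matrix (Fin n) (Fin n) ℝ} (hY : Y.IsSymm) {θ : ℝ}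
    (hθ : ∀ θ', Module.End.HasEigenvalue (Matrix.toLin' Y) θ' → θ' ≤ θ) (x : Fin n → ℝ) :
    x ⬝ᵥ (Y *ᵥ x) ≤ θ * nrm x ^ 2 := by
  have hH : (θ • (1 : Matrix (Fin n) (Fin n) ℝ) - Y).IsHermitian := by
    unfold Matrix.IsHermitian
    rw [Matrix.conjTranspose_sub, Matrix.conjTranspose_smul, Matrix.conjTranspose_one,
      Matrix.conjTranspose_eq_transpose_of_trivial, hY.eq]
    simp
  have hpsd := hH.posSemidef_iff_eigenvalues_nonneg.2 fun i => by
    have h1 := hH.mulVec_eigenvectorBasis i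
    have h2 : Y *ᵥ (hH.eigenvectorBasis i).ofLp =
        (θ - hH.eigenvalues i) • (hH.eigenvectorBasis i).ofLp := by
      rw [Matrix.sub_mulVec, Matrix.smul_mulVec, Matrix.one_mulVec] at h1
      rw [sub_smul, ← h1]; simp
    have h3 := hθ _ (hasEigenvalue_toLin'_iff.2 ⟨_, fun h0 => hH.eigenvectorBasis.toBasis.ne_zero i
      (by simpa using (WithLp.ofLp_eq_zero 2).1 h0), h2⟩)
    simp only [Pi.zero_apply]
    linarith
  have h := hpsd.dotProduct_mulVec_nonneg x
  simp only [star_trivial] at h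
  rw [Matrix.sub_mulVec, Matrix.smul_mulVec, Matrix.one_mulVec, dotProduct_sub, dotProduct_smul,
    dotProduct_self_eq, smul_eq_mul] at h
  linarith

lemma abs_dotProduct_mulVec_le {A : Matrix (Fin n) (Fin n) ℝ} {M : ℝ} (hA : OpBound A M)
    (x : Fin n → ℝ) : |x ⬝ᵥ (A *ᵥ x)| ≤ M * nrm x ^ 2 := by
  refine (abs_dotProduct_le _ _).trans ?_
  have := mul_le_mul_of_nonneg_left (hA x) (nrm_nonneg x)
  nlinarith

lemma spike_mulVec (l : ℝ) (v x : Fin n → ℝ) (A : Matrix (Fin n) (Fin n) ℝ) :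
    (l • Matrix.vecMulVec v v + A) *ᵥ x = (l * (v ⬝ᵥ x)) • v + A *ᵥ x := by
  rw [Matrix.add_mulVec, Matrix.smul_mulVec, Matrix.vecMulVec_mulVec, mul_smul]
  simp

lemma spike_isSymm (l : ℝ) (v : Fin n → ℝ) {A : Matrix (Fin n) (Fin n) ℝ} (hA : A.IsSymm) :
    (l • Matrix.vecMulVec v v + A).IsSymm := by
  ext a b
  simp [Matrix.vecMulVec_apply, hA.apply a b, mul_comm]

lemma top_eigenvalue_ge {A : Matrix (Fin n) (Fin n) ℝ} (hA : A.IsSymm) {M l θ : ℝ}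
    (hM : OpBound A M) {v : Fin n → ℝ} (hv : nrm v = 1)
    (hθ : ∀ θ', Module.End.HasEigenvalue (Matrix.toLin' (l • Matrix.vecMulVec v v + A)) θ' →
      θ' ≤ θ) : l - M ≤ θ := by
  have h := dotProduct_mulVec_le_of_eigenvalues_le (spike_isSymm l v hA) hθ v
  rw [spike_mulVec, dotProduct_add, dotProduct_smul, dotProduct_self_eq, hv] at h
  have h2 := abs_dotProduct_mulVec_le hM v
  rw [hv] at h2
  have h3 := neg_abs_le (v ⬝ᵥ (A *ᵥ v))
  simp at h
  linarith

lemma opBound_smul {A : Matrix (Fin n) (Fin n) ℝ} {M s : ℝ} (hM : OpBound A M) (hs : |s| = 1) :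
    OpBound (s • A) M := fun x => by
  rw [Matrix.smul_mulVec, nrm_smul, hs, one_mul]
  exact hM x

/-- Testing against `v` forces `|lam₀| ≥ |lam| - M > M`. On the side opposite to `lam` the spike
pushes the wrong way, so an eigenvalue there has modulus at most `M`. -/
lemma leading_eigenvalue_sign {W : Matrix (Fin n) (Fin n) ℝ} (hW : W.IsSymm) {M lam lam₀ : ℝ}
    (hM : OpBound W M) {v : Fin n → ℝ} (hv : nrm v = 1) (hlam : 2 * M < |lam|) (hM0 : 0 ≤ M)
    (h : IsLeadingEigenvalue (lam • Matrix.vecMulVec v v + W) lam₀) : 0 < lam₀ * lam := by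
  have hlam0 : lam ≠ 0 := by rintro rfl; simp at hlam; linarith
  set s : ℝ := Real.sign lam with hs
  have hss : s * s = 1 := by
    rcases lt_or_gt_of_ne hlam0 with h | h
    · simp [hs, Real.sign_of_neg h]
    · simp [hs, Real.sign_of_pos h]
  have hs1 : |s| = 1 := by
    rcases lt_or_gt_of_ne hlam0 with h | h
    · simp [hs, Real.sign_of_neg h]
    · simp [hs, Real.sign_of_pos h]
  have hsl : s * lam = |lam| := by
    rcases lt_or_gt_of_ne hlam0 with h | h
    · simp [hs, Real.sign_of_neg h, abs_of_neg h]
    · simp [hs, Real.sign_of_pos h, abs_of_pos h]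
  have hsY : s • (lam • Matrix.vecMulVec v v + W) = |lam| • Matrix.vecMulVec v v + s • W := by
    rw [smul_add, smul_smul, hsl]
  have hge : |lam| - M ≤ |lam₀| := by
    refine top_eigenvalue_ge (A := s • W) (hW.smul s) (opBound_smul hM hs1) hv fun θ' hθ' => ?_
    rw [← hsY, hasEigenvalue_toLin'_iff] at hθ'
    obtain ⟨w, hw0, hw⟩ := hθ'
    have h2 := h.2 (s * θ') (hasEigenvalue_toLin'_iff.2 ⟨w, hw0, by
      rw [Matrix.smul_mulVec] at hw
      rw [mul_smul, ← hw, smul_smul, hss, one_smul]⟩)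
    rw [abs_mul, hs1, one_mul] at h2
    exact (le_abs_self _).trans h2
  obtain ⟨w, hw0, hw⟩ := hasEigenvalue_toLin'_iff.1 h.1
  have hwpos : 0 < nrm w ^ 2 :=
    pow_pos (lt_of_le_of_ne (nrm_nonneg _) fun h => hw0 (nrm_eq_zero.1 h.symm)) 2
  rw [spike_mulVec] at hw
  have h1 : lam * (v ⬝ᵥ w) ^ 2 + w ⬝ᵥ (W *ᵥ w) = lam₀ * nrm w ^ 2 := by
    have := congrArg (fun z => w ⬝ᵥ z) hw
    simp only [dotProduct_add, dotProduct_smul, dotProduct_self_eq, smul_eq_mul,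
      dotProduct_comm w v] at this
    linarith
  by_contra! hcon
  have h2 := abs_dotProduct_mulVec_le hM w
  have h3 : s * lam₀ = -|lam₀| := by
    rcases lt_or_gt_of_ne hlam0 with h | h
    · have : 0 ≤ lam₀ := by nlinarith
      simp [hs, Real.sign_of_neg h, abs_of_nonneg this]
    · have : lam₀ ≤ 0 := by nlinarith
      simp [hs, Real.sign_of_pos h, abs_of_nonpos this]
  have h4 : |lam| * (v ⬝ᵥ w) ^ 2 + s * (w ⬝ᵥ (W *ᵥ w)) = -|lam₀| * nrm w ^ 2 := by
    rw [← hsl, ← h3, mul_assoc, mul_assoc, ← h1]; ring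
  have h5 : |s * (w ⬝ᵥ (W *ᵥ w))| ≤ M * nrm w ^ 2 := by rw [abs_mul, hs1, one_mul]; exact h2
  have h6 := neg_abs_le (s * (w ⬝ᵥ (W *ᵥ w)))
  have h7 : 0 ≤ |lam| * (v ⬝ᵥ w) ^ 2 := by positivity
  have h8 : |lam₀| * nrm w ^ 2 ≤ M * nrm w ^ 2 := by linarith
  have h9 : |lam₀| ≤ M := le_of_mul_le_mul_right h8 hwpos
  linarith

end Spectral

/-! ### Leave-one-out analysis of the top eigenvector. -/

section Entrywise

variable {n : ℕ}

/-- `A` with the `i`-th row and column set to zero. -/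
def compress (i : Fin n) (A : Matrix (Fin n) (Fin n) ℝ) : Matrix (Fin n) (Fin n) ℝ := fun a b =>
  if a = i ∨ b = i then 0 else A a b

lemma compress_mulVec_self (i : Fin n) (A : Matrix (Fin n) (Fin n) ℝ) (x : Fin n → ℝ) :
    (compress i A *ᵥ x) i = 0 := by
  simp [Matrix.mulVec, dotProduct, compress]

lemma mulVec_eq_compress_add {i j : Fin n} (hj : j ≠ i) (A : Matrix (Fin n) (Fin n) ℝ)
    (x : Fin n → ℝ) : (A *ᵥ x) j = (compress i A *ᵥ x) j + A j i * x i := by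
  simp only [Matrix.mulVec, dotProduct, compress, hj, false_or]
  rw [← Finset.add_sum_erase _ _ (Finset.mem_univ i),
    ← Finset.add_sum_erase Finset.univ (fun k => (if k = i then 0 else A j k) * x k)
      (Finset.mem_univ i), add_comm]
  simp only [if_true, zero_mul, zero_add]
  congr 1
  refine Finset.sum_congr rfl fun k hk => ?_
  rw [if_neg (Finset.ne_of_mem_erase hk)]

lemma nrm_le_of_abs_le {x y : Fin n → ℝ} (h : ∀ i, |x i| ≤ |y i|) : nrm x ≤ nrm y := by
  refine (sq_le_sq₀ (nrm_nonneg _) (nrm_nonneg _)).1 ?_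
  rw [nrm_sq, nrm_sq]
  exact Finset.sum_le_sum fun i _ => sq_le_sq.2 (h i)

/-- The compression is `P A P` for a coordinate projection `P`. -/
lemma opBound_compress {A : Matrix (Fin n) (Fin n) ℝ} {M : ℝ} (hM : OpBound A M) (hM0 : 0 ≤ M)
    (i : Fin n) : OpBound (compress i A) M := by
  intro x
  have h1 : nrm (compress i A *ᵥ x) ≤ nrm (A *ᵥ Function.update x i 0) := by
    refine nrm_le_of_abs_le fun j => ?_
    by_cases hj : j = i
    · subst hj; rw [compress_mulVec_self]; simp
    · rw [mulVec_eq_compress_add hj A]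
      refine le_of_eq (congrArg _ ?_)
      simp only [Function.update_self, mul_zero, add_zero, Matrix.mulVec, dotProduct, compress]
      refine Finset.sum_congr rfl fun k _ => ?_
      by_cases hk : k = i
      · simp [hk]
      · simp [hk]
  have h2 : nrm (Function.update x i 0) ≤ nrm x := by
    refine nrm_le_of_abs_le fun j => ?_
    by_cases hj : j = i
    · subst hj; simp
    · simp [hj]
  exact h1.trans ((hM _).trans (mul_le_mul_of_nonneg_left h2 hM0))

lemma nrm_pow_mulVec_le {A : Matrix (Fin n) (Fin n) ℝ} {M : ℝ} (hM : OpBound A M) (hM0 : 0 ≤ M)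
    (v : Fin n → ℝ) (t : ℕ) : nrm (A ^ t *ᵥ v) ≤ M ^ t * nrm v := by
  induction t with
  | zero => simp
  | succ t ih =>
    rw [pow_succ', ← Matrix.mulVec_mulVec, pow_succ', mul_assoc]
    exact (hM _).trans (mul_le_mul_of_nonneg_left ih hM0)

/-- Truncated Neumann series for `(θ - B)⁻¹ v`. -/
def neumann (B : Matrix (Fin n) (Fin n) ℝ) (θ : ℝ) (v : Fin n → ℝ) (T : ℕ) : Fin n → ℝ :=
  ∑ t ∈ Finset.range T, (θ ^ (t + 1))⁻¹ • (B ^ t *ᵥ v)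

lemma neumann_eq (B : Matrix (Fin n) (Fin n) ℝ) {θ : ℝ} (hθ : θ ≠ 0) (v : Fin n → ℝ) (T : ℕ) :
    θ • neumann B θ v T - B *ᵥ neumann B θ v T = v - (θ ^ T)⁻¹ • (B ^ T *ᵥ v) := by
  induction T with
  | zero => simp [neumann]
  | succ T ih =>
    have h : neumann B θ v (T + 1) = neumann B θ v T + (θ ^ (T + 1))⁻¹ • (B ^ T *ᵥ v) := by
      rw [neumann, Finset.sum_range_succ, ← neumann]
    rw [h, smul_add, Matrix.mulVec_add, add_sub_add_comm, ih, Matrix.mulVec_smul,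
      Matrix.mulVec_mulVec, ← pow_succ', smul_smul]
    have : θ * (θ ^ (T + 1))⁻¹ = (θ ^ T)⁻¹ := by rw [pow_succ']; field_simp
    rw [this]
    abel

lemma sum_geometric_le {M θ : ℝ} (hM0 : 0 ≤ M) (hθ : M < θ) (T : ℕ) :
    ∑ t ∈ Finset.range T, (θ ^ (t + 1))⁻¹ * M ^ t ≤ 1 / (θ - M) := by
  have hθ0 : 0 < θ := hM0.trans_lt hθ
  have hpos : 0 < θ - M := sub_pos.2 hθ
  have h : ∑ t ∈ Finset.range T, (θ ^ (t + 1))⁻¹ * M ^ t = (1 - (M / θ) ^ T) / (θ - M) := by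
    induction T with
    | zero => simp
    | succ T ih =>
      rw [Finset.sum_range_succ, ih, div_pow, div_pow]
      field_simp
      ring
  rw [h]
  gcongr
  have : 0 ≤ (M / θ) ^ T := by positivity
  linarith

/-- Leave-one-out bound for the entries of an eigenvector of a perturbed rank-one matrix. -/
lemma abs_eigenvector_entry_le {A : Matrix (Fin n) (Fin n) ℝ} {M θ a τ : ℝ} (hM : OpBound A M)
    (hM0 : 0 ≤ M) (hθ : M < θ) {u v : Fin n → ℝ} (hv : nrm v = 1)
    (hu : θ • u = a • v + A *ᵥ u) (i : Fin n) {T : ℕ} (hT : 1 ≤ T)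
    (hrow : ∀ t < T, |(A *ᵥ (compress i A ^ t *ᵥ v)) i| ≤ τ * M ^ t) :
    |θ * u i - a * v i| ≤ |a| * (τ / (θ - M)) +
      M * (|a| / (θ - M) * ((M / θ) ^ T + (τ / (θ - M) + 2 * (|v i| / θ) * M))) := by
  have hθ0 : 0 < θ := hM0.trans_lt hθ
  have hpos : 0 < θ - M := sub_pos.2 hθ
  set B := compress i A with hB
  have hBM : OpBound B M := opBound_compress hM hM0 i
  have hτ : 0 ≤ τ := by simpa using (abs_nonneg _).trans (hrow 0 hT)
  set x := neumann B θ v T with hx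
  set δ := (θ ^ T)⁻¹ • (B ^ T *ᵥ v) with hδ
  have hxB : θ • x - B *ᵥ x = v - δ := neumann_eq B hθ0.ne' v T
  -- Row `i` of `B` vanishes, so a single factor of `B` suffices; hence `1 ≤ T`.
  have hδi : δ i = 0 := by
    obtain ⟨T', rfl⟩ : ∃ T', T = T' + 1 := ⟨T - 1, by omega⟩
    simp [hδ, pow_succ', ← Matrix.mulVec_mulVec, hB, compress_mulVec_self]
  have hxi : x i = v i / θ := by
    have := congrFun hxB i
    simp only [Pi.sub_apply, Pi.smul_apply, smul_eq_mul, hδi, hB, compress_mulVec_self] at this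
    rw [eq_div_iff hθ0.ne']
    linarith
  have hδn : nrm δ ≤ (M / θ) ^ T := by
    rw [hδ, nrm_smul, abs_of_pos (by positivity), div_pow, div_eq_inv_mul]
    have := nrm_pow_mulVec_le hBM hM0 v T
    rw [hv, mul_one] at this
    gcongr
  have hAx : |(A *ᵥ x) i| ≤ τ / (θ - M) := by
    have h1 : (A *ᵥ x) i = ∑ t ∈ Finset.range T, (θ ^ (t + 1))⁻¹ * (A *ᵥ (B ^ t *ᵥ v)) i := by
      rw [hx, neumann, Matrix.mulVec_sum, Finset.sum_apply]
      simp [Matrix.mulVec_smul]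
    rw [h1]
    calc |∑ t ∈ Finset.range T, (θ ^ (t + 1))⁻¹ * (A *ᵥ (B ^ t *ᵥ v)) i|
        ≤ ∑ t ∈ Finset.range T, (θ ^ (t + 1))⁻¹ * (τ * M ^ t) := by
          refine (Finset.abs_sum_le_sum_abs _ _).trans (Finset.sum_le_sum fun t ht => ?_)
          rw [abs_mul, abs_of_pos (by positivity : 0 < (θ ^ (t + 1))⁻¹)]
          exact mul_le_mul_of_nonneg_left (hrow t (Finset.mem_range.1 ht)) (by positivity)
      _ = τ * ∑ t ∈ Finset.range T, (θ ^ (t + 1))⁻¹ * M ^ t := by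
          rw [Finset.mul_sum]
          exact Finset.sum_congr rfl fun t _ => by ring
      _ ≤ τ * (1 / (θ - M)) := mul_le_mul_of_nonneg_left (sum_geometric_le hM0 hθ T) hτ
      _ = τ / (θ - M) := by ring
  have hcol : nrm (A *ᵥ Pi.single i 1) ≤ M := by
    simpa [nrm_single] using hM (Pi.single i 1)
  have hAii : |A i i| ≤ M := by
    have h1 := abs_apply_le (A *ᵥ Pi.single i 1) i
    rw [Matrix.mulVec_single_one] at h1 hcol
    exact h1.trans hcol
  -- `A - B` lives on row and column `i`: the row contributes the small number `(A x) i`, the column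
  -- the small factor `x i = v i / θ`.
  have hE : A *ᵥ x - B *ᵥ x =
      Pi.single i ((A *ᵥ x) i - x i * A i i) + x i • (A *ᵥ Pi.single i 1) := by
    ext j
    by_cases hj : j = i
    · subst hj; simp [hB, compress_mulVec_self]
    · rw [Pi.sub_apply, mulVec_eq_compress_add hj]
      simp [hj, hB, mul_comm]
  have hEn : nrm (A *ᵥ x - B *ᵥ x) ≤ τ / (θ - M) + 2 * (|v i| / θ) * M := by
    have hxa : |x i| = |v i| / θ := by rw [hxi, abs_div, abs_of_pos hθ0]
    rw [hE]
    refine (nrm_add_le _ _).trans ?_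
    rw [nrm_single, nrm_smul]
    have h1 : |(A *ᵥ x) i - x i * A i i| ≤ |(A *ᵥ x) i| + |x i| * |A i i| := by
      rw [← abs_mul]; exact abs_sub _ _
    have h2 : |x i| * |A i i| ≤ |x i| * M := by gcongr
    have h3 : |x i| * nrm (A *ᵥ Pi.single i 1) ≤ |x i| * M := by gcongr
    rw [← hxa]
    linarith
  -- The residual `d` solves the eigenvector equation up to a small source, so it is small in
  -- Euclidean norm. The crude bound `|(A d) i| ≤ M ‖d‖` is then affordable.
  set d := u - a • x with hd
  have hdeq : θ • d = A *ᵥ d + a • (δ + (A *ᵥ x - B *ᵥ x)) := by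
    have h1 : θ • x = v - δ + B *ᵥ x := by rw [← hxB]; abel
    rw [hd, smul_sub, smul_comm θ a x, h1, hu, Matrix.mulVec_sub, Matrix.mulVec_smul]
    module
  have hdn : nrm d ≤ |a| / (θ - M) * ((M / θ) ^ T + (τ / (θ - M) + 2 * (|v i| / θ) * M)) := by
    have h1 : θ * nrm d ≤ M * nrm d +
        |a| * ((M / θ) ^ T + (τ / (θ - M) + 2 * (|v i| / θ) * M)) := by
      have h2 : θ * nrm d = nrm (θ • d) := by rw [nrm_smul, abs_of_pos hθ0]
      rw [h2, hdeq]
      refine (nrm_add_le _ _).trans (add_le_add (hM d) ?_)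
      rw [nrm_smul]
      exact mul_le_mul_of_nonneg_left ((nrm_add_le _ _).trans (add_le_add hδn hEn)) (abs_nonneg _)
    rw [div_mul_eq_mul_div, le_div_iff₀ hpos]
    linarith
  have hfin : θ * u i - a * v i = a * (A *ᵥ x) i + (A *ᵥ d) i := by
    have h1 := congrFun hu i
    simp only [Pi.add_apply, Pi.smul_apply, smul_eq_mul] at h1
    rw [hd, Matrix.mulVec_sub, Matrix.mulVec_smul]
    simp only [Pi.sub_apply, Pi.smul_apply, smul_eq_mul]
    linarith
  rw [hfin]
  refine (abs_add_le _ _).trans (add_le_add ?_ ?_)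
  · rw [abs_mul]; gcongr
  · exact (abs_apply_le _ _).trans ((hM d).trans (by gcongr))

/-- Taking norms in `θ u = a v + A u` gives `||a| - θ| ≤ M`. So `a` may be replaced by `± θ` at
relative cost `h`, and its sign is the global sign of `u`. -/
lemma exists_sign_abs_sub_le {A : Matrix (Fin n) (Fin n) ℝ} {M θ a τ h ρ : ℝ} (hM : OpBound A M)
    (hM0 : 0 ≤ M) (hθ : 0 < θ) {u v : Fin n → ℝ} (hnu : nrm u = 1) (hv : nrm v = 1)
    (hu : θ • u = a • v + A *ᵥ u) {T : ℕ} (hT : 1 ≤ T)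
    (hrow : ∀ i, ∀ t < T, |(A *ᵥ (compress i A ^ t *ᵥ v)) i| ≤ τ * M ^ t)
    (hMh : M ≤ h * θ) (hh : h ≤ 1 / 10) (hτρ : τ ≤ ρ * θ) :
    ∃ ς : ℝ, (ς = 1 ∨ ς = -1) ∧ ∀ i, |u i - ς * v i| ≤ 2 * h * |v i| + 2 * ρ + 2 * h * h ^ T := by
  have hh0 : 0 ≤ h := by
    by_contra! hc
    nlinarith
  have hMθ : M < θ := by nlinarith
  have hpos : 0 < θ - M := sub_pos.2 hMθ
  have ha : a • v = θ • u - A *ᵥ u := by rw [hu]; simp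
  have ha1 : |a| ≤ θ + M := by
    have h1 := nrm_sub_le (θ • u) (A *ᵥ u)
    rw [← ha, nrm_smul, nrm_smul, hv, hnu, abs_of_pos hθ] at h1
    have h2 := hM u
    rw [hnu] at h2
    linarith
  have ha2 : θ - M ≤ |a| := by
    have h1 := nrm_add_le (a • v) (A *ᵥ u)
    rw [← hu, nrm_smul, nrm_smul, hv, hnu, abs_of_pos hθ] at h1
    have h2 := hM u
    rw [hnu] at h2
    linarith
  have ha0 : a ≠ 0 := by rintro rfl; simp at ha2; linarith
  refine ⟨Real.sign a, ?_, fun i => ?_⟩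
  · rcases lt_or_gt_of_ne ha0 with h | h
    · exact Or.inr (Real.sign_of_neg h)
    · exact Or.inl (Real.sign_of_pos h)
  have hτ : 0 ≤ τ := by simpa using (abs_nonneg _).trans (hrow i 0 hT)
  have hρ : 0 ≤ ρ := by
    by_contra! hc
    nlinarith
  have key := abs_eigenvector_entry_le hM hM0 hMθ hv hu i hT (hrow i)
  have hsign : |a * v i - θ * (Real.sign a * v i)| ≤ M * |v i| := by
    have h1 : a = Real.sign a * |a| := by
      rcases lt_or_gt_of_ne ha0 with h | h
      · simp [Real.sign_of_neg h, abs_of_neg h]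
      · simp [Real.sign_of_pos h, abs_of_pos h]
    have h2 : |Real.sign a| = 1 := by
      rcases lt_or_gt_of_ne ha0 with h | h
      · simp [Real.sign_of_neg h]
      · simp [Real.sign_of_pos h]
    have h3 : a * v i - θ * (Real.sign a * v i) = Real.sign a * ((|a| - θ) * v i) := by
      nth_rewrite 1 [h1]; ring
    rw [h3, abs_mul, h2, one_mul, abs_mul]
    gcongr
    rw [abs_le]
    constructor <;> linarith
  have hfrac : |a| / (θ - M) ≤ 5 / 4 := by
    rw [div_le_iff₀ hpos]
    nlinarith
  have hfrac' : τ / (θ - M) ≤ 10 / 9 * ρ := by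
    rw [div_le_iff₀ hpos]
    nlinarith [mul_le_mul_of_nonneg_left (show θ * (9 / 10) ≤ θ - M by nlinarith) hρ]
  have hMT : M / θ ≤ h := by rwa [div_le_iff₀ hθ]
  have hvi := abs_nonneg (v i)
  have e1 : |a| * (τ / (θ - M)) ≤ 5 / 4 * ρ * θ := by
    have : |a| * (τ / (θ - M)) = |a| / (θ - M) * τ := by ring
    rw [this, mul_assoc]
    gcongr
  have e2 : M * (|a| / (θ - M) * ((M / θ) ^ T + (τ / (θ - M) + 2 * (|v i| / θ) * M))) ≤
      h * θ * (5 / 4 * (h ^ T + (10 / 9 * ρ + 2 * |v i| * h))) := by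
    have : 2 * (|v i| / θ) * M = 2 * |v i| * (M / θ) := by ring
    rw [this]
    gcongr
  have e3 : |θ * (u i - Real.sign a * v i)| ≤
      θ * (2 * h * |v i| + 2 * ρ + 2 * h * h ^ T) := by
    have : θ * (u i - Real.sign a * v i) =
      (θ * u i - a * v i) + (a * v i - θ * (Real.sign a * v i)) := by ring
    rw [this]
    refine (abs_add_le _ _).trans ?_
    have hT0 : 0 ≤ h ^ T := by positivity
    have f1 : h * ρ ≤ 1 / 10 * ρ := by gcongr
    have f2 : h * |v i| * h ≤ h * |v i| * (1 / 10) := by gcongr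
    have f3 : M * |v i| ≤ h * θ * |v i| := by gcongr
    have f4 : 0 ≤ h * h ^ T := by positivity
    have f5 : 5 / 4 * ρ + h * (5 / 4 * (h ^ T + (10 / 9 * ρ + 2 * |v i| * h))) + h * |v i| ≤
        2 * h * |v i| + 2 * ρ + 2 * h * h ^ T := by
      have : 0 ≤ h * |v i| := by positivity
      nlinarith
    have f6 := mul_le_mul_of_nonneg_left f5 hθ.le
    nlinarith
  rw [abs_mul, abs_of_pos hθ] at e3
  exact le_of_mul_le_mul_left e3 hθ

end Entrywise

/-! ### Exponential moments of centred squares. -/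

section SquareMGF

variable {Ω : Type*} [MeasurableSpace Ω] {μ : Measure Ω} [IsProbabilityMeasure μ]

lemma lintegral_exp_neg_mul_sq {b : ℝ} (hb : 0 < b) :
    ∫⁻ t : ℝ, ENNReal.ofReal (Real.exp (-b * t ^ 2)) = ENNReal.ofReal (Real.sqrt (Real.pi / b)) := by
  rw [← integral_gaussian, ofReal_integral_eq_lintegral_ofReal (integrable_exp_neg_mul_sq hb)
    (Filter.Eventually.of_forall fun t => (Real.exp_pos _).le)]

lemma lintegral_exp_mul_sub_sq {b : ℝ} (hb : 0 < b) (x : ℝ) :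
    ∫⁻ t : ℝ, ENNReal.ofReal (Real.exp (x * t - b * t ^ 2)) =
      ENNReal.ofReal (Real.exp (x ^ 2 / (4 * b))) * ENNReal.ofReal (Real.sqrt (Real.pi / b)) := by
  have h : ∀ t : ℝ, ENNReal.ofReal (Real.exp (x * t - b * t ^ 2)) =
      ENNReal.ofReal (Real.exp (x ^ 2 / (4 * b))) *
        ENNReal.ofReal (Real.exp (-b * (t - x / (2 * b)) ^ 2)) := fun t => by
    rw [← ENNReal.ofReal_mul (Real.exp_pos _).le, ← Real.exp_add]
    congr 2
    field_simp
    ring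
  simp only [h]
  rw [lintegral_const_mul _ (by fun_prop),
    lintegral_sub_right_eq_self (fun t : ℝ => ENNReal.ofReal (Real.exp (-b * t ^ 2))),
    lintegral_exp_neg_mul_sq hb]

/-- Gaussian linearisation: `exp (x² / (4ν))` is proportional to the integral of `exp (x t - ν t²)`
over `t`. Tonelli reduces the bound to the moment generating function. -/
lemma lintegral_exp_sq_le {X : Ω → ℝ} {ν : ℝ≥0} (hν : 0 < ν) (hX : Measurable X)
    (hsub : HasSubgaussianMGF X ν μ) :
    ∫⁻ ω, ENNReal.ofReal (Real.exp (X ω ^ 2 / (4 * ν))) ∂μ ≤ ENNReal.ofReal (Real.sqrt 2) := by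
  have hν' : (0 : ℝ) < ν := hν
  have hc : 0 < Real.sqrt (Real.pi / ν) := by positivity
  have hc' : ENNReal.ofReal (Real.sqrt (Real.pi / ν)) ≠ 0 := by simpa using hc
  rw [← ENNReal.mul_le_mul_iff_left hc' ENNReal.ofReal_ne_top,
    ← lintegral_mul_const _ (by fun_prop)]
  simp only [← lintegral_exp_mul_sub_sq hν']
  rw [lintegral_lintegral_swap (by fun_prop)]
  have h : ∀ t : ℝ, ∫⁻ ω, ENNReal.ofReal (Real.exp (X ω * t - ν * t ^ 2)) ∂μ ≤
      ENNReal.ofReal (Real.exp (-(ν / 2) * t ^ 2)) := fun t => by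
    have hint := hsub.integrable_exp_mul t
    have h3 : ∀ ω, Real.exp (X ω * t - ν * t ^ 2) =
        Real.exp (t * X ω) * Real.exp (-(ν * t ^ 2)) := fun ω => by
      rw [← Real.exp_add]; ring_nf
    simp only [h3]
    rw [← ofReal_integral_eq_lintegral_ofReal (hint.mul_const _)
      (Filter.Eventually.of_forall fun ω => by positivity), integral_mul_const]
    refine ENNReal.ofReal_le_ofReal ?_
    have := hsub.mgf_le t
    rw [mgf] at this
    calc _ ≤ Real.exp (ν * t ^ 2 / 2) * Real.exp (-(ν * t ^ 2)) := by gcongr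
      _ = _ := by rw [← Real.exp_add]; ring_nf
  refine (lintegral_mono h).trans ?_
  rw [lintegral_exp_neg_mul_sq (by positivity), ← ENNReal.ofReal_mul (by positivity),
    ← Real.sqrt_mul (by norm_num)]
  refine le_of_eq ?_
  congr 2
  field_simp

lemma exp_le_one_add_add_sq_mul (y : ℝ) : Real.exp y ≤ 1 + y + y ^ 2 * Real.exp |y| := by
  have h1 : 1 ≤ Real.exp |y| := Real.one_le_exp (abs_nonneg y)
  rcases le_or_gt |y| 1 with h | h
  · have h2 := (abs_le.1 (Real.abs_exp_sub_one_sub_id_le h)).2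
    nlinarith [sq_nonneg y]
  · rcases le_or_gt 0 y with hy | hy
    · rw [abs_of_nonneg hy] at *
      have h2 : 1 ≤ y ^ 2 := by nlinarith
      nlinarith [mul_le_mul_of_nonneg_right h2 (Real.exp_pos y).le]
    · have h3 : Real.exp y ≤ 1 := Real.exp_le_one_iff.2 hy.le
      rw [abs_of_neg hy] at *
      nlinarith [sq_nonneg y]

lemma exp_sq_bounds {X : Ω → ℝ} {ν : ℝ≥0} (hν : 0 < ν) (hX : Measurable X)
    (hsub : HasSubgaussianMGF X ν μ) :
    Integrable (fun ω => Real.exp (X ω ^ 2 / (4 * ν))) μ ∧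
      ∫ ω, Real.exp (X ω ^ 2 / (4 * ν)) ∂μ ≤ Real.sqrt 2 := by
  have h := lintegral_exp_sq_le hν hX hsub
  have hint : Integrable (fun ω => Real.exp (X ω ^ 2 / (4 * ν))) μ := by
    refine ⟨by fun_prop, ?_⟩
    rw [hasFiniteIntegral_iff_ofReal (Filter.Eventually.of_forall fun ω => (Real.exp_pos _).le)]
    exact h.trans_lt ENNReal.ofReal_lt_top
  refine ⟨hint, ?_⟩
  rwa [← ofReal_integral_eq_lintegral_ofReal hint
    (Filter.Eventually.of_forall fun ω => (Real.exp_pos _).le),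
    ENNReal.ofReal_le_ofReal_iff (Real.sqrt_nonneg _)] at h

lemma sq_le_exp {X ν : ℝ} (hν : 0 < ν) : X ^ 2 ≤ 4 * ν * (Real.exp (X ^ 2 / (4 * ν)) - 1) := by
  have h1 := Real.add_one_le_exp (X ^ 2 / (4 * ν))
  have h2 : X ^ 2 = 4 * ν * (X ^ 2 / (4 * ν)) := by field_simp
  have h3 : 0 < 4 * ν := by positivity
  calc X ^ 2 = 4 * ν * (X ^ 2 / (4 * ν)) := h2
    _ ≤ _ := by gcongr; linarith

lemma sqrt_two_le : Real.sqrt 2 ≤ 3 / 2 := by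
  rw [Real.sqrt_le_left (by norm_num)]; norm_num

lemma mgf_sq_sub_le {X : Ω → ℝ} {ν : ℝ≥0} (hν : 0 < ν) (hX : Measurable X)
    (hsub : HasSubgaussianMGF X ν μ) {σ : ℝ} (hσ : ∫ ω, X ω ^ 2 ∂μ = σ ^ 2) {s : ℝ}
    (hs : |s| ≤ 1 / (16 * ν)) :
    Integrable (fun ω => Real.exp (s * (X ω ^ 2 - σ ^ 2))) μ ∧
      ∫ ω, Real.exp (s * (X ω ^ 2 - σ ^ 2)) ∂μ ≤ Real.exp (288 * ν ^ 2 * s ^ 2) := by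
  have hν' : (0 : ℝ) < ν := hν
  obtain ⟨hint, hle⟩ := exp_sq_bounds hν hX hsub
  have hsqint : Integrable (fun ω => X ω ^ 2) μ := by
    refine ((hint.sub (integrable_const (1 : ℝ))).const_mul (4 * (ν : ℝ))).mono' (by fun_prop)
      (Filter.Eventually.of_forall fun ω => ?_)
    rw [Real.norm_eq_abs, abs_of_nonneg (sq_nonneg _)]
    exact sq_le_exp hν'
  have hσν : σ ^ 2 ≤ 2 * ν := by
    rw [← hσ]
    calc ∫ ω, X ω ^ 2 ∂μ ≤ ∫ ω, 4 * (ν : ℝ) * (Real.exp (X ω ^ 2 / (4 * ν)) - 1) ∂μ :=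
          integral_mono hsqint ((hint.sub (integrable_const (1 : ℝ))).const_mul (4 * (ν : ℝ)))
            fun ω => sq_le_exp hν'
      _ = 4 * ν * (∫ ω, Real.exp (X ω ^ 2 / (4 * ν)) ∂μ - 1) := by
          rw [integral_const_mul, integral_sub hint (integrable_const _)]; simp
      _ ≤ 4 * ν * (3 / 2 - 1) := by
          have := sqrt_two_le
          gcongr; linarith
      _ = 2 * ν := by ring
  -- In `exp y ≤ 1 + y + y² exp |y|` the linear term has mean zero. The bound on `s` keeps the
  -- remainder below a multiple of the integrable `exp (X² / (4ν))`; the constants are `192 = 128 ·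
  -- 3/2` and `288 = 192 · 3/2`.
  set Y : Ω → ℝ := fun ω => s * (X ω ^ 2 - σ ^ 2) with hY
  have hpt : ∀ ω, Real.exp (Y ω) ≤
      1 + Y ω + 192 * ν ^ 2 * s ^ 2 * Real.exp (X ω ^ 2 / (4 * ν)) := by
    intro ω
    refine (exp_le_one_add_add_sq_mul _).trans ?_
    set w : ℝ := X ω ^ 2 / ν with hw
    have hw0 : 0 ≤ w := by positivity
    have hXw : X ω ^ 2 = ν * w := by rw [hw]; field_simp
    have hd : |X ω ^ 2 - σ ^ 2| ≤ ν * (w + 2) := by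
      rw [hXw, abs_le]
      constructor <;> nlinarith [sq_nonneg σ]
    have h1 : |Y ω| ≤ (w + 2) / 16 := by
      rw [hY, abs_mul]
      calc |s| * |X ω ^ 2 - σ ^ 2| ≤ 1 / (16 * ν) * (ν * (w + 2)) := by gcongr
        _ = (w + 2) / 16 := by field_simp
    have h2 : Y ω ^ 2 ≤ s ^ 2 * (ν ^ 2 * (w + 2) ^ 2) := by
      have : Y ω ^ 2 = s ^ 2 * |X ω ^ 2 - σ ^ 2| ^ 2 := by rw [hY, sq_abs]; ring
      rw [this, ← mul_pow (ν : ℝ)]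
      gcongr
    have h3 : (w + 2) ^ 2 ≤ 128 * Real.exp ((w + 2) / 8) := by
      have := Real.quadratic_le_exp_of_nonneg (show 0 ≤ (w + 2) / 8 by positivity)
      nlinarith
    have h4 : Real.exp ((w + 2) / 8) * Real.exp ((w + 2) / 16) ≤
        3 / 2 * Real.exp (w / 4) := by
      have h5 : Real.exp (3 / 8) ≤ 3 / 2 := by
        have h7 : Real.exp (3 / 8) ^ 8 ≤ (3 / 2) ^ 8 := by
          rw [← Real.exp_nat_mul]
          have h8 : Real.exp ((8 : ℕ) * (3 / 8)) = Real.exp 1 ^ 3 := by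
            rw [← Real.exp_nat_mul]; norm_num
          rw [h8]
          have h9 := Real.exp_one_lt_d9
          have h10 : Real.exp 1 ^ 3 ≤ 2.72 ^ 3 := by gcongr; linarith
          norm_num at h10 ⊢
          linarith
        exact le_of_pow_le_pow_left₀ (by norm_num) (by norm_num) h7
      have h6 : Real.exp ((w + 2) / 8) * Real.exp ((w + 2) / 16) ≤
          Real.exp (3 / 8) * Real.exp (w / 4) := by
        rw [← Real.exp_add, ← Real.exp_add]
        refine Real.exp_le_exp.2 ?_
        linarith
      exact h6.trans (by gcongr)
    have hw4 : X ω ^ 2 / (4 * ν) = w / 4 := by rw [hw]; field_simp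
    rw [hw4]
    have h5 : Y ω ^ 2 * Real.exp |Y ω| ≤
        (s ^ 2 * (ν ^ 2 * (128 * Real.exp ((w + 2) / 8)))) * Real.exp ((w + 2) / 16) := by
      refine mul_le_mul (h2.trans (by gcongr)) (Real.exp_le_exp.2 h1) (Real.exp_pos _).le
        (by positivity)
    have h6 : (s ^ 2 * (ν ^ 2 * (128 * Real.exp ((w + 2) / 8)))) * Real.exp ((w + 2) / 16) ≤
        s ^ 2 * ν ^ 2 * 128 * (3 / 2 * Real.exp (w / 4)) := by
      have : (s ^ 2 * (ν ^ 2 * (128 * Real.exp ((w + 2) / 8)))) * Real.exp ((w + 2) / 16) =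
        s ^ 2 * ν ^ 2 * 128 * (Real.exp ((w + 2) / 8) * Real.exp ((w + 2) / 16)) := by ring
      rw [this]
      gcongr
    linarith
  have hYint : Integrable Y μ := (hsqint.sub (integrable_const _)).const_mul s
  have hbound : Integrable
      (fun ω => 1 + Y ω + 192 * ν ^ 2 * s ^ 2 * Real.exp (X ω ^ 2 / (4 * ν))) μ :=
    ((integrable_const _).add hYint).add (hint.const_mul _)
  have hexpint : Integrable (fun ω => Real.exp (Y ω)) μ := by
    refine hbound.mono' (by fun_prop) (Filter.Eventually.of_forall fun ω => ?_)
    rw [Real.norm_eq_abs, abs_of_pos (Real.exp_pos _)]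
    exact hpt ω
  refine ⟨hexpint, ?_⟩
  have hY0 : ∫ ω, Y ω ∂μ = 0 := by
    rw [hY, integral_const_mul, integral_sub hsqint (integrable_const _), hσ]
    simp
  calc ∫ ω, Real.exp (Y ω) ∂μ
      ≤ ∫ ω, (1 + Y ω + 192 * ν ^ 2 * s ^ 2 * Real.exp (X ω ^ 2 / (4 * ν))) ∂μ :=
        integral_mono hexpint hbound hpt
    _ = 1 + 192 * ν ^ 2 * s ^ 2 * ∫ ω, Real.exp (X ω ^ 2 / (4 * ν)) ∂μ := by
        have e1 : ∫ ω, (1 + Y ω) ∂μ = 1 := by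
          rw [integral_add (integrable_const _) hYint, hY0]; simp
        rw [integral_add (f := fun ω => 1 + Y ω) ((integrable_const _).add hYint)
          (hint.const_mul _), e1, integral_const_mul]
    _ ≤ 1 + 192 * ν ^ 2 * s ^ 2 * (3 / 2) := by
        have := sqrt_two_le
        gcongr; linarith
    _ ≤ Real.exp (288 * ν ^ 2 * s ^ 2) := by
        have := Real.add_one_le_exp (288 * (ν : ℝ) ^ 2 * s ^ 2)
        linarith

/-- Bernstein-type upper tail for weighted sums of centred squares. -/
lemma measure_sum_sq_ge_le {ι : Type*} [Fintype ι] {X : ι → Ω → ℝ} {ν : ℝ≥0} (hν : 0 < ν)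
    (hind : iIndepFun X μ) (hX : ∀ i, Measurable (X i))
    (hsub : ∀ i, HasSubgaussianMGF (X i) ν μ) {σ : ℝ} (hσ : ∀ i, ∫ ω, X i ω ^ 2 ∂μ = σ ^ 2)
    (d : ι → ℝ) {s : ℝ} (hs : 0 ≤ s) (hd : ∀ i, |s * d i| ≤ 1 / (16 * ν)) (t : ℝ) :
    μ {ω | t ≤ ∑ i, d i * (X i ω ^ 2 - σ ^ 2)} ≤
      ENNReal.ofReal (Real.exp (-(s * t) + 288 * ν ^ 2 * s ^ 2 * ∑ i, d i ^ 2)) := by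
  set Y : ι → Ω → ℝ := fun i ω => d i * (X i ω ^ 2 - σ ^ 2) with hY
  have hYm : ∀ i, Measurable (Y i) := fun i => by
    have := hX i
    fun_prop
  have hYind : iIndepFun Y μ :=
    hind.comp (fun i x => d i * (x ^ 2 - σ ^ 2)) fun i => by fun_prop
  have hb : ∀ i, Integrable (fun ω => Real.exp (s * Y i ω)) μ ∧
      mgf (Y i) μ s ≤ Real.exp (288 * ν ^ 2 * (s * d i) ^ 2) := fun i => by
    have := mgf_sq_sub_le hν (hX i) (hsub i) (hσ i) (hd i)
    simp only [mul_assoc] at this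
    simpa only [mgf, hY, mul_assoc] using this
  have hsum : ∀ ω, ∑ i, d i * (X i ω ^ 2 - σ ^ 2) = (∑ i, Y i) ω := fun ω => by
    rw [Finset.sum_apply]
  simp only [hsum]
  have hint := hYind.integrable_exp_mul_sum (t := s) (s := Finset.univ) hYm fun i _ => (hb i).1
  have h1 := measure_ge_le_exp_mul_mgf t hs hint
  rw [← ofReal_measureReal]
  refine ENNReal.ofReal_le_ofReal (h1.trans ?_)
  rw [hYind.mgf_sum hYm, Real.exp_add, Finset.mul_sum, Real.exp_sum, ← neg_mul]
  gcongr with i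
  · exact fun i _ => mgf_nonneg
  · refine (hb i).2.trans (le_of_eq ?_)
    ring_nf

end SquareMGF

/-! ### Concentration of `‖W q‖²` and of the leave-one-out rows. -/

section QuadraticForm

variable {n : ℕ}

lemma sq_sum_eq_sum_sq_add (a : Fin n → ℝ) :
    (∑ k, a k) ^ 2 = ∑ k, a k ^ 2 + 2 * ∑ k, a k * ∑ l, if l < k then a l else 0 := by
  have h1 : ∑ k, a k * (∑ l, if l < k then a l else 0) =
      ∑ k, ∑ l, if l < k then a k * a l else 0 := by
    refine Finset.sum_congr rfl fun k _ => ?_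
    rw [Finset.mul_sum]
    exact Finset.sum_congr rfl fun l _ => by split_ifs <;> simp
  have h2 : ∑ k, ∑ l, (if l < k then a k * a l else 0) =
      ∑ k, ∑ l, if k < l then a k * a l else 0 := by
    rw [Finset.sum_comm]
    exact Finset.sum_congr rfl fun k _ => Finset.sum_congr rfl fun l _ => by
      split_ifs <;> ring
  have h3 : ∑ k, a k ^ 2 = ∑ k, ∑ l, if l = k then a k * a l else 0 := by
    exact Finset.sum_congr rfl fun k _ => by simp [sq]
  rw [two_mul, h1]
  nth_rewrite 2 [h2]
  rw [h3, ← Finset.sum_add_distrib, ← Finset.sum_add_distrib, sq, Finset.sum_mul_sum]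
  refine Finset.sum_congr rfl fun k _ => ?_
  rw [← Finset.sum_add_distrib, ← Finset.sum_add_distrib]
  refine Finset.sum_congr rfl fun l _ => ?_
  rcases lt_trichotomy l k with h | h | h
  · simp [h, h.ne, h.not_gt]
  · simp [h]
  · simp [h, h.ne', h.not_gt]

/-- The restriction of a vector to the coordinates below `k`. -/
def below (q : Fin n → ℝ) (k : Fin n) : Fin n → ℝ := fun l => if l < k then q l else 0

lemma nrm_below_sq_le (q : Fin n → ℝ) (k : Fin n) : nrm (below q k) ^ 2 ≤ nrm q ^ 2 := by
  have h : nrm (below q k) ≤ nrm q := nrm_le_of_abs_le fun i => by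
    unfold below
    split_ifs <;> simp
  exact pow_le_pow_left₀ (nrm_nonneg _) h 2

/-- Squaring each row sum splits off a diagonal of centred squares. Ordering the cross terms by
column makes the rest a predictable linear form. -/
lemma nrm_mulVec_sq_sub_eq (A : Matrix (Fin n) (Fin n) ℝ) (q : Fin n → ℝ) (σ : ℝ) :
    nrm (A *ᵥ q) ^ 2 - nrm q ^ 2 * n * σ ^ 2 =
      ∑ j, ∑ k, q k ^ 2 * (A j k ^ 2 - σ ^ 2) +
        2 * ∑ j, ∑ k, (q k * (A *ᵥ below q k) j) * A j k := by
  have h1 : nrm (A *ᵥ q) ^ 2 = ∑ j, ∑ k, q k ^ 2 * A j k ^ 2 +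
        2 * ∑ j, ∑ k, (q k * (A *ᵥ below q k) j) * A j k := by
    rw [nrm_sq, Finset.mul_sum, ← Finset.sum_add_distrib]
    refine Finset.sum_congr rfl fun j _ => ?_
    rw [Matrix.mulVec, dotProduct, sq_sum_eq_sum_sq_add]
    congr 1
    · exact Finset.sum_congr rfl fun k _ => by ring
    · congr 1
      refine Finset.sum_congr rfl fun k _ => ?_
      have : (A *ᵥ below q k) j = ∑ l, if l < k then A j l * q l else 0 := by
        simp [Matrix.mulVec, dotProduct, below]
      rw [this]
      ring
  have h2 : nrm q ^ 2 * n * σ ^ 2 = ∑ _j : Fin n, ∑ k, q k ^ 2 * σ ^ 2 := by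
    rw [Finset.sum_const, Finset.card_univ, Fintype.card_fin, nsmul_eq_mul, nrm_sq,
      ← Finset.sum_mul]
    ring
  rw [h1, h2]
  simp only [mul_sub, Finset.sum_sub_distrib]
  ring

lemma IsNoise.integral_sq {Ω : Type*} [MeasurableSpace Ω] {μ : Measure Ω}
    {W : Ω → Matrix (Fin n) (Fin n) ℝ} {σ : ℝ} {ν : ℝ≥0} (hW : IsNoise μ W σ ν) (i j : Fin n) :
    ∫ ω, W ω i j ^ 2 ∂μ = σ ^ 2 := by
  have h0 : ∫ ω, W ω i j ∂μ = 0 := by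
    have h := (hW.symmetric i j).integral_eq
    rw [integral_neg] at h
    linarith
  rw [← hW.variance_eq i j, variance_of_integral_eq_zero (hW.measurable i j).aemeasurable h0]

variable {Ω : Type*} [MeasurableSpace Ω] {μ : Measure Ω} [IsProbabilityMeasure μ]
  {W : Ω → Matrix (Fin n) (Fin n) ℝ} {σ : ℝ} {ν : ℝ≥0}

lemma IsNoise.measure_diag_abs_ge_le (hW : IsNoise μ W σ ν) (hν : 0 < ν) (hn : 1 ≤ n)
    {q : Fin n → ℝ} (hq : ∀ k, |q k| ≤ 1) (hm : 1 ≤ nrm q ^ 2) {L : ℝ} (hL : 1 ≤ L) :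
    μ {ω | 448 * ν * nrm q ^ 2 * Real.sqrt n * L ≤
        |∑ j, ∑ k, q k ^ 2 * (W ω j k ^ 2 - σ ^ 2)|} ≤
      ENNReal.ofReal (2 * Real.exp (-(12 * L))) := by
  have hν' : (0 : ℝ) < ν := hν
  have hn' : (1 : ℝ) ≤ n := by exact_mod_cast hn
  set m := nrm q ^ 2 with hmdef
  set d : {p : Fin n × Fin n // p.1 ≤ p.2} → ℝ := fun p =>
    if p.1.1 = p.1.2 then q p.1.1 ^ 2 else q p.1.2 ^ 2 + q p.1.1 ^ 2 with hd
  have hq2 : ∀ k, q k ^ 2 ≤ 1 := fun k => by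
    rw [← sq_abs]; exact pow_le_one₀ (abs_nonneg _) (hq k)
  have hd0 : ∀ p, 0 ≤ d p := fun p => by simp only [hd]; split_ifs <;> positivity
  have hd2 : ∀ p, d p ≤ 2 := fun p => by
    simp only [hd]; split_ifs <;> linarith [hq2 p.1.1, hq2 p.1.2]
  have hdsum : ∑ p, d p = n * m := by
    have h := sum_upper_eq (n := n) fun _ k => q k ^ 2
    simp only [Finset.sum_const, Finset.card_univ, Fintype.card_fin, nsmul_eq_mul] at h
    rw [hmdef, nrm_sq, ← h]
  have hdsq : ∑ p, d p ^ 2 ≤ 2 * (n * m) := by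
    rw [← hdsum, Finset.mul_sum]
    exact Finset.sum_le_sum fun p _ => by nlinarith [hd0 p, hd2 p]
  -- At this scale the variance term is only `9 m / 16` while the gain is `14 m L`, leaving at least
  -- `12 L` as `m, L ≥ 1`. It also meets the cap `1 / (16 ν)`, since `d ≤ 2`.
  set s : ℝ := 1 / (32 * ν * Real.sqrt n) with hs
  have hsqrt : 1 ≤ Real.sqrt n := Real.one_le_sqrt.2 hn'
  have hs0 : 0 ≤ s := by positivity
  have hs1 : s ≤ 1 / (32 * ν) := by
    rw [hs]
    refine one_div_le_one_div_of_le (by positivity) ?_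
    exact le_mul_of_one_le_right (by positivity) hsqrt
  have hsd : ∀ p, |s * d p| ≤ 1 / (16 * ν) := fun p => by
    rw [abs_of_nonneg (mul_nonneg hs0 (hd0 p))]
    calc s * d p ≤ 1 / (32 * ν) * 2 := mul_le_mul hs1 (hd2 p) (hd0 p) (by positivity)
      _ = 1 / (16 * ν) := by field_simp; norm_num
  have hsd' : ∀ p, |s * -d p| ≤ 1 / (16 * ν) := fun p => by
    rw [mul_neg, abs_neg]; exact hsd p
  set t : ℝ := 448 * ν * m * Real.sqrt n * L with ht
  have hexp : -(s * t) + 288 * ν ^ 2 * s ^ 2 * ∑ p, d p ^ 2 ≤ -(12 * L) := by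
    have e1 : s * t = 14 * m * L := by rw [hs, ht]; field_simp; norm_num
    have e2 : 288 * ν ^ 2 * s ^ 2 * ∑ p, d p ^ 2 ≤ 288 * ν ^ 2 * s ^ 2 * (2 * (n * m)) := by
      gcongr
    have e3 : 288 * (ν : ℝ) ^ 2 * s ^ 2 * (2 * (n * m)) = 9 / 16 * m := by
      rw [hs, div_pow, mul_pow, mul_pow, Real.sq_sqrt (by positivity)]
      field_simp
      norm_num
    rw [e1]
    nlinarith [mul_le_mul hm hL zero_le_one (by linarith : (0 : ℝ) ≤ m)]
  have hsub : ∀ p : {p : Fin n × Fin n // p.1 ≤ p.2}, HasSubgaussianMGF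
      (fun ω => W ω p.1.1 p.1.2) ν μ := fun p => hW.subgaussian _ _
  have hmeas : ∀ p : {p : Fin n × Fin n // p.1 ≤ p.2}, Measurable
      (fun ω => W ω p.1.1 p.1.2) := fun p => hW.measurable _ _
  have k1 := measure_sum_sq_ge_le hν hW.indep hmeas hsub (fun p => hW.integral_sq _ _) d hs0 hsd t
  have k2 := measure_sum_sq_ge_le hν hW.indep hmeas hsub (fun p => hW.integral_sq _ _)
    (fun p => -d p) hs0 hsd' t
  simp only [neg_sq] at k2
  have hsum : ∀ ω, ∑ j, ∑ k, q k ^ 2 * (W ω j k ^ 2 - σ ^ 2) =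
      ∑ p : {p : Fin n × Fin n // p.1 ≤ p.2}, d p * (W ω p.1.1 p.1.2 ^ 2 - σ ^ 2) := fun ω => by
    rw [← sum_upper_eq]
    refine Finset.sum_congr rfl fun p _ => ?_
    simp only [hd]
    split_ifs with heq
    · rw [← heq]
    · rw [(hW.isSymm ω).apply p.1.1 p.1.2]; ring
  rw [two_mul, ENNReal.ofReal_add (Real.exp_pos _).le (Real.exp_pos _).le]
  have hmono := ENNReal.ofReal_le_ofReal (Real.exp_le_exp.2 hexp)
  refine le_trans (measure_mono ?_) ((measure_union_le _ _).trans
    (add_le_add (k1.trans hmono) (k2.trans hmono)))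
  intro ω hω
  rw [Set.mem_ofPred_eq, hsum] at hω
  rcases le_abs.1 hω with h | h
  · exact Or.inl h
  · refine Or.inr ?_
    simpa [Finset.sum_neg_distrib] using h

/-- Concentration of the squared length of `W q`. -/
lemma IsNoise.measure_nrm_sq_abs_gt_le (hW : IsNoise μ W σ ν) (hν : 0 < ν) (hn : 1 ≤ n)
    {q : Fin n → ℝ} (hq : ∀ k, |q k| ≤ 1) (hm : 1 ≤ nrm q ^ 2) {L : ℝ} (hL : 1 ≤ L) :
    μ {ω | 546 * ν * nrm q ^ 2 * Real.sqrt n * L <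
        |nrm (W ω *ᵥ q) ^ 2 - nrm q ^ 2 * n * σ ^ 2|} ≤
      ENNReal.ofReal ((n ^ 2 + 2) * (2 * Real.exp (-(12 * L)))) := by
  have hν' : (0 : ℝ) < ν := hν
  have hn' : (1 : ℝ) ≤ n := by exact_mod_cast hn
  set m := nrm q ^ 2 with hmdef
  have hm0 : 0 < m := by linarith
  have hL0 : 0 < L := by linarith
  set e := ENNReal.ofReal (2 * Real.exp (-(12 * L))) with he
  set H := 7 * Real.sqrt (ν * m * L) with hH
  have hHsq : H ^ 2 = 49 * (ν * m * L) := by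
    rw [hH, mul_pow, Real.sq_sqrt (by positivity)]; norm_num
  have hh : ∀ p : Fin n × Fin n, μ {ω | H ≤ |(W ω *ᵥ below q p.2) p.1|} ≤ e := by
    rintro ⟨j, k⟩
    have h := hW.measure_bilin_abs_ge_le hν (Pi.single j 1) (below q k) (t := H) (V := m)
      (by positivity) hm0 (by simpa [nrm_single] using nrm_below_sq_le q k)
    simp only [single_dotProduct, one_mul] at h
    refine h.trans (ENNReal.ofReal_le_ofReal ?_)
    gcongr
    rw [hHsq]
    have : 49 * (ν * m * L) / (4 * ν * m) = 49 / 4 * L := by field_simp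
    rw [this]
    linarith
  -- The random bracket is at most `V` as soon as all `n²` partial row sums are below `H`. The final
  -- constant is `546 = 448 + 2 · 49`.
  set V := n * m * H ^ 2 with hV
  set t := 49 * ν * m * Real.sqrt n * L with ht
  have hchaos := hW.measure_predictable_abs_ge_le hν
    (fun A => Matrix.of fun j k => q k * (A *ᵥ below q k) j)
    (fun j k => by
      simp only [Matrix.mulVec, dotProduct, Matrix.of_apply]
      fun_prop)
    -- The coefficient of entry `(j, k)` reads entries `(j, l)` with `l < k`, and `j + l < j + k`.
    -- This rank is compatible with the symmetry.
    (fun a b => a + b) (fun a b => add_comm _ _)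
    (fun j k A B hAB => by
      simp only [Matrix.mulVec, dotProduct, Matrix.of_apply, below]
      congr 1
      refine Finset.sum_congr rfl fun l _ => ?_
      split_ifs with hl
      · rw [hAB j l (by simpa using hl)]
      · simp) (t := t) (V := V) (by positivity) (by positivity)
  have hchaos' : μ {ω | t ≤ |∑ j, ∑ k, (q k * (W ω *ᵥ below q k) j) * W ω j k| ∧
      ∑ j, ∑ k, (q k * (W ω *ᵥ below q k) j) ^ 2 ≤ V} ≤ e := by
    refine hchaos.trans (ENNReal.ofReal_le_ofReal ?_)
    gcongr
    have : t ^ 2 / (4 * ν * V) = 49 / 4 * L := by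
      rw [hV, hHsq, ht, mul_pow, mul_pow _ (Real.sqrt n), Real.sq_sqrt (by positivity)]
      field_simp
    rw [this]
    linarith
  have hdiag := hW.measure_diag_abs_ge_le hν hn hq hm hL
  have hsub : {ω | 546 * ν * m * Real.sqrt n * L <
        |nrm (W ω *ᵥ q) ^ 2 - m * n * σ ^ 2|} ⊆
      (⋃ p ∈ (Finset.univ : Finset (Fin n × Fin n)), {ω | H ≤ |(W ω *ᵥ below q p.2) p.1|}) ∪
      ({ω | t ≤ |∑ j, ∑ k, (q k * (W ω *ᵥ below q k) j) * W ω j k| ∧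
        ∑ j, ∑ k, (q k * (W ω *ᵥ below q k) j) ^ 2 ≤ V} ∪
      {ω | 448 * ν * m * Real.sqrt n * L ≤
        |∑ j, ∑ k, q k ^ 2 * (W ω j k ^ 2 - σ ^ 2)|}) := by
    intro ω hω
    by_contra hcon
    simp only [Set.mem_union, not_or, Set.mem_iUnion, not_exists, Finset.mem_univ, exists_const,
      Set.mem_ofPred_eq, not_le, not_and] at hcon
    obtain ⟨c1, c2, c3⟩ := hcon
    have hVle : ∑ j, ∑ k, (q k * (W ω *ᵥ below q k) j) ^ 2 ≤ V := by
      calc ∑ j, ∑ k, (q k * (W ω *ᵥ below q k) j) ^ 2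
          ≤ ∑ _j : Fin n, ∑ k, q k ^ 2 * H ^ 2 := by
            refine Finset.sum_le_sum fun j _ => Finset.sum_le_sum fun k _ => ?_
            rw [mul_pow, ← sq_abs ((W ω *ᵥ below q k) j)]
            have := (c1 (j, k)).le
            gcongr
        _ = V := by
            rw [Finset.sum_const, Finset.card_univ, Fintype.card_fin, nsmul_eq_mul,
              ← Finset.sum_mul, ← nrm_sq]
            ring
    have c4 : |∑ j, ∑ k, (q k * (W ω *ᵥ below q k) j) * W ω j k| < t := by
      by_contra! hge
      exact absurd (c2 hge) (not_lt.2 hVle)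
    rw [Set.mem_ofPred_eq] at hω
    refine absurd hω (not_lt.2 ?_)
    rw [hmdef, nrm_mulVec_sq_sub_eq]
    refine (abs_add_le _ _).trans ?_
    rw [abs_mul, abs_two, ← hmdef]
    linarith
  refine (measure_mono hsub).trans ((measure_union_le _ _).trans
    ((add_le_add ((measure_biUnion_finset_le _ _).trans (Finset.sum_le_sum fun p _ => hh p))
      ((measure_union_le _ _).trans (add_le_add hchaos' hdiag))).trans (le_of_eq ?_)))
  rw [ENNReal.ofReal_mul (p := (n : ℝ) ^ 2 + 2) (by positivity), ← he, Finset.sum_const, Finset.card_univ,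
    Fintype.card_prod, Fintype.card_fin, nsmul_eq_mul,
    ENNReal.ofReal_add (by positivity) (by norm_num), ENNReal.ofReal_pow (by positivity),
    ENNReal.ofReal_natCast, ENNReal.ofReal_ofNat]
  push_cast
  ring

/-- Tail bound for the rows of the noise against the vectors of the leave-one-out iteration. -/
lemma IsNoise.measure_row_abs_gt_le (hW : IsNoise μ W σ ν) (hν : 0 < ν)
    {v : Fin n → ℝ} (hv : nrm v = 1) {M : ℝ} (hM : 0 < M) {L : ℝ} (hL : 1 ≤ L) (i : Fin n)
    (T : ℕ) :
    μ {ω | OpBound (W ω) M ∧ 7 * Real.sqrt (ν * L) * M ^ T <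
        |(W ω *ᵥ (compress i (W ω) ^ T *ᵥ v)) i|} ≤
      ENNReal.ofReal (2 * Real.exp (-(12 * L))) := by
  have hν' : (0 : ℝ) < ν := hν
  have hL0 : 0 < L := by linarith
  set t := 7 * Real.sqrt (ν * L) * M ^ T with ht
  have hcm : ∀ a b, Measurable fun A : Fin n → Fin n → ℝ => compress i A a b := fun a b => by
    unfold compress
    split_ifs
    · exact measurable_const
    · fun_prop
  have hcmv : ∀ (T : ℕ) (a : Fin n), Measurable fun A : Fin n → Fin n → ℝ =>
      (compress i A ^ T *ᵥ v) a := by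
    intro T
    induction T with
    | zero => intro a; simp
    | succ T ih =>
      intro a
      simp only [pow_succ', ← Matrix.mulVec_mulVec]
      simp only [Matrix.mulVec, dotProduct]
      refine Finset.measurable_sum _ fun k _ => (hcm a k).mul ?_
      exact ih k
  have h := hW.measure_predictable_abs_ge_le hν
    (fun A => Matrix.of fun j k => if j = i then (compress i A ^ T *ᵥ v) k else 0)
    (fun j k => by
      simp only [Matrix.of_apply]
      split_ifs
      · exact hcmv T k
      · exact measurable_const)
    -- Two ranks suffice: the coefficients come from the compressed matrix, which sees only entries
    -- off row and column `i`.
    (fun a b => if a = i ∨ b = i then 1 else 0) (fun a b => by simp only [or_comm])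
    (fun j k A B hAB => by
      simp only [Matrix.of_apply]
      split_ifs with hj
      · have : compress i A = compress i B := by
          ext a b
          unfold compress
          split_ifs with hab
          · rfl
          · exact hAB a b (by simp [hab, hj])
        rw [this]
      · rfl) (t := t) (V := (M ^ T) ^ 2) (by positivity) (by positivity)
  refine (measure_mono ?_).trans (h.trans (ENNReal.ofReal_le_ofReal ?_))
  · rintro ω ⟨h1, h2⟩
    simp only [Matrix.of_apply, Set.mem_ofPred_eq]
    have e1 : ∑ j, ∑ k, (if j = i then (compress i (W ω) ^ T *ᵥ v) k else 0) * W ω j k =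
        (W ω *ᵥ (compress i (W ω) ^ T *ᵥ v)) i := by
      rw [Finset.sum_eq_single i (fun j _ hj => by simp [hj]) (by simp)]
      simp only [if_true]
      conv_rhs => rw [Matrix.mulVec, dotProduct]
      exact Finset.sum_congr rfl fun k _ => mul_comm _ _
    have e2 : ∑ j, ∑ k, (if j = i then (compress i (W ω) ^ T *ᵥ v) k else 0) ^ 2 =
        nrm (compress i (W ω) ^ T *ᵥ v) ^ 2 := by
      rw [Finset.sum_eq_single i (fun j _ hj => by simp [hj]) (by simp), nrm_sq]
      simp
    rw [e1, e2]
    refine ⟨h2.le, ?_⟩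
    have := nrm_pow_mulVec_le (opBound_compress h1 hM.le i) hM.le v T
    rw [hv, mul_one] at this
    exact pow_le_pow_left₀ (nrm_nonneg _) this 2
  · gcongr
    have : t ^ 2 / (4 * ν * (M ^ T) ^ 2) = 49 / 4 * L := by
      rw [ht, mul_pow, mul_pow, Real.sq_sqrt (by positivity)]
      field_simp
      norm_num
    rw [this]
    linarith

end QuadraticForm

/-! ### Stability of threshold sets and signs. -/

section Threshold

variable {n : ℕ}

/-- The smallest grid point is `(log n) ^ (-L / 2) = (2 n) ^ (-1 / 2)`, so entrywise errors of order
`ε₀ / √n` are negligible against every threshold. -/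
lemma grid_lower_bound {α : ℝ} (hL : 1 < Real.log n) (hα : α ∈ grid n) :
    0 < α ∧ 1 ≤ 2 * n * α ^ 2 := by
  have hL0 : 0 < Real.log n := one_pos.trans hL
  have hLL : 0 < Real.log (Real.log n) := Real.log_pos hL
  have hn : (0 : ℝ) < n := by
    rcases Nat.eq_zero_or_pos n with rfl | h
    · simp at hL; linarith
    · exact_mod_cast h
  have hge : Real.log n ^ (-gridLength n / 2) ≤ α := by
    rcases hα with ⟨k, -, hk, rfl⟩ | rfl
    · have hk' : (k : ℝ) < gridLength n := Nat.lt_ceil.1 (by omega)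
      exact Real.rpow_le_rpow_of_exponent_le hL.le (by linarith)
    · exact le_rfl
  have hpos : 0 < Real.log n ^ (-gridLength n / 2) := Real.rpow_pos_of_pos hL0 _
  refine ⟨hpos.trans_le hge, ?_⟩
  have hsq : (Real.log n ^ (-gridLength n / 2)) ^ 2 = (2 * (n : ℝ))⁻¹ := by
    rw [← Real.rpow_natCast, ← Real.rpow_mul hL0.le, Real.rpow_def_of_pos hL0]
    have : Real.log (Real.log n) * (-gridLength n / 2 * (2 : ℕ)) = -Real.log (2 * n) := by
      rw [gridLength]; push_cast; field_simp
    rw [this, Real.exp_neg, Real.exp_log (by positivity)]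
  have h1 : (2 * (n : ℝ))⁻¹ ≤ α ^ 2 := by
    rw [← hsq]; exact pow_le_pow_left₀ hpos.le hge 2
  calc (1 : ℝ) = 2 * n * (2 * (n : ℝ))⁻¹ := by field_simp
    _ ≤ 2 * n * α ^ 2 := by gcongr

lemma mem_largeSet {v : Fin n → ℝ} {α : ℝ} {i : Fin n} : i ∈ largeSet v α ↔ α ≤ |v i| := by
  simp [largeSet]

lemma abs_abs_sub_le {x y ς : ℝ} (hς : ς = 1 ∨ ς = -1) : |(|x| - |y|)| ≤ |x - ς * y| := by
  rcases hς with rfl | rfl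
  · simpa using abs_abs_sub_abs_le_abs_sub x y
  · have := abs_abs_sub_abs_le_abs_sub x (-y)
    simpa using this

variable {u v : Fin n → ℝ} {ε₀ α ς : ℝ}

/-- The gap is assumed for `u`, not for `v`, so this covers every admissible threshold and not only
the one supplied by the signal. -/
lemma largeSet_eq_of_close (hε : 0 < ε₀) (hε1 : ε₀ ≤ 1) (hα : 0 < α) (hς : ς = 1 ∨ ς = -1)
    (hclose : ∀ i, |u i - ς * v i| ≤ ε₀ / 50 * (|v i| + α))
    (hgap : {i | (1 - ε₀ / 2) * α < |u i| ∧ |u i| < (1 + ε₀ / 2) * α} = (∅ : Set (Fin n))) :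
    largeSet u α = largeSet v α := by
  ext i
  rw [mem_largeSet, mem_largeSet]
  have h1 := abs_le.1 ((abs_abs_sub_le hς).trans (hclose i))
  have hi : ¬ ((1 - ε₀ / 2) * α < |u i| ∧ |u i| < (1 + ε₀ / 2) * α) := fun h =>
    (Set.eq_empty_iff_forall_notMem.1 hgap i) h
  rw [not_and, not_lt] at hi
  have hεα : 0 < ε₀ * α := by positivity
  constructor
  · intro h
    by_contra! hlt
    have h2 := hi (by nlinarith)
    nlinarith
  · intro h
    have : (1 - ε₀ / 2) * α < |u i| := by nlinarith
    have h2 := hi this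
    nlinarith

lemma isAdmissible_of_close (hε : 0 < ε₀) (hε1 : ε₀ ≤ 1) (hα : 0 < α) (hς : ς = 1 ∨ ς = -1)
    (hclose : ∀ i, |u i - ς * v i| ≤ ε₀ / 50 * (|v i| + α)) (hgrid : α ∈ grid n)
    (hcard : 1 / (α ^ 2 * Real.log n ^ 2) < ((largeSet v α).card : ℝ))
    (hgap : {i | |v i| ∈ Set.Icc ((1 - ε₀) * α) ((1 + ε₀) * α)} = (∅ : Set (Fin n))) :
    IsAdmissible (ε₀ / 2) u α := by
  have hgapu : {i | (1 - ε₀ / 2) * α < |u i| ∧ |u i| < (1 + ε₀ / 2) * α} =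
      (∅ : Set (Fin n)) := by
    refine Set.eq_empty_iff_forall_notMem.2 fun i hi => ?_
    obtain ⟨hi1, hi2⟩ := hi
    have h1 := abs_le.1 ((abs_abs_sub_le hς).trans (hclose i))
    have hi : ¬ (|v i| ∈ Set.Icc ((1 - ε₀) * α) ((1 + ε₀) * α)) :=
      Set.eq_empty_iff_forall_notMem.1 hgap i
    rw [Set.mem_Icc, not_and, not_le] at hi
    have hεα : 0 < ε₀ * α := by positivity
    rcases lt_or_ge |v i| ((1 - ε₀) * α) with h | h
    · nlinarith
    · have := hi h
      nlinarith
  refine ⟨hgrid, ?_, hgapu⟩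
  rw [largeSet_eq_of_close hε hε1 hα hς hclose hgapu]
  exact hcard.le

lemma sign_eq_of_close (hε1 : ε₀ ≤ 1) (hα : 0 < α) (hς : ς = 1 ∨ ς = -1)
    (hclose : ∀ i, |u i - ς * v i| ≤ ε₀ / 50 * (|v i| + α)) {i : Fin n}
    (hi : i ∈ largeSet v α) : Real.sign (u i) = ς * Real.sign (v i) := by
  rw [mem_largeSet] at hi
  have h0 : 0 < |v i| := hα.trans_le hi
  have h1 : |u i - ς * v i| < |v i| := by
    refine (hclose i).trans_lt ?_
    nlinarith
  rw [abs_lt] at h1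
  rcases lt_or_gt_of_ne (abs_pos.1 h0) with h | h <;> rcases hς with rfl | rfl
  · rw [abs_of_neg h] at h1
    rw [Real.sign_of_neg h, Real.sign_of_neg (by linarith)]; norm_num
  · rw [abs_of_neg h] at h1
    rw [Real.sign_of_neg h, Real.sign_of_pos (by linarith)]; norm_num
  · rw [abs_of_pos h] at h1
    rw [Real.sign_of_pos h, Real.sign_of_pos (by linarith)]; norm_num
  · rw [abs_of_pos h] at h1
    rw [Real.sign_of_pos h, Real.sign_of_neg (by linarith)]; norm_num

end Threshold

/-! ### Deterministic error analysis of the estimator. -/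

section Estimator

variable {n : ℕ}

/-- The signs of `v` on `{k : |v k| ≥ α}`, extended by zero. -/
def signVec (v : Fin n → ℝ) (α : ℝ) : Fin n → ℝ := fun k =>
  if k ∈ largeSet v α then Real.sign (v k) else 0

variable {u v : Fin n → ℝ} {α ς : ℝ}

lemma sign_mul_self_of_ne_zero {x : ℝ} (hx : x ≠ 0) : Real.sign x * Real.sign x = 1 := by
  rcases lt_or_gt_of_ne hx with h | h
  · simp [Real.sign_of_neg h]
  · simp [Real.sign_of_pos h]

lemma ne_zero_of_mem_largeSet (hα : 0 < α) {k : Fin n} (hk : k ∈ largeSet v α) : v k ≠ 0 :=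
  abs_pos.1 (hα.trans_le (mem_largeSet.1 hk))

lemma abs_signVec_le (v : Fin n → ℝ) (α : ℝ) (k : Fin n) : |signVec v α k| ≤ 1 := by
  unfold signVec
  split_ifs
  · rcases Real.sign_apply_eq (v k) with h | h | h <;> simp [h]
  · simp

lemma nrm_signVec_sq (v : Fin n → ℝ) (hα : 0 < α) :
    nrm (signVec v α) ^ 2 = (largeSet v α).card := by
  rw [nrm_sq]
  have : ∀ k, signVec v α k ^ 2 = if k ∈ largeSet v α then 1 else 0 := fun k => by
    unfold signVec
    split_ifs with h
    · rw [sq, sign_mul_self_of_ne_zero (ne_zero_of_mem_largeSet hα h)]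
    · simp
  simp [this]

lemma card_mul_le_dotProduct_signVec (v : Fin n → ℝ) (α : ℝ) :
    (largeSet v α).card * α ≤ v ⬝ᵥ signVec v α := by
  have h : v ⬝ᵥ signVec v α = ∑ k ∈ largeSet v α, |v k| := by
    have : ∀ k, v k * signVec v α k = if k ∈ largeSet v α then |v k| else 0 := fun k => by
      unfold signVec
      split_ifs with h
      · rcases lt_trichotomy (v k) 0 with h | h | h
        · simp [Real.sign_of_neg h, abs_of_neg h]
        · simp [h]
        · simp [Real.sign_of_pos h, abs_of_pos h]
      · simp
    simp [dotProduct, this, Finset.sum_ite_mem]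
  rw [h, ← nsmul_eq_mul]
  exact Finset.card_nsmul_le_sum _ _ _ fun k hk => mem_largeSet.1 hk

lemma sum_yTilde (Y : Matrix (Fin n) (Fin n) ℝ) (hI : largeSet u α = largeSet v α)
    (hsign : ∀ k ∈ largeSet v α, Real.sign (u k) = ς * Real.sign (v k)) (j : Fin n) :
    ∑ k ∈ largeSet u α, yTilde Y u α j k =
      (if j ∈ largeSet v α then ς * Real.sign (v j) else 1) * (ς * (Y *ᵥ signVec v α) j) := by
  have hQ : ∀ k, (if k ∈ largeSet u α then Real.sign (u k) else 1) =
      if k ∈ largeSet v α then ς * Real.sign (v k) else 1 := fun k => by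
    rw [hI]
    split_ifs with h
    · exact hsign k h
    · rfl
  have h1 : ∀ k, yTilde Y u α j k = (if j ∈ largeSet v α then ς * Real.sign (v j) else 1) *
      Y j k * (if k ∈ largeSet v α then ς * Real.sign (v k) else 1) := fun k => by
    rw [← hQ, ← hQ]
    simp [yTilde, signMatrix, Matrix.mul_apply, Matrix.diagonal_apply]
  have h2 : (Y *ᵥ signVec v α) j = ∑ k ∈ largeSet v α, Y j k * Real.sign (v k) := by
    simp [Matrix.mulVec, dotProduct, signVec, Finset.sum_ite_mem]
  rw [h2, hI, Finset.mul_sum, Finset.mul_sum]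
  refine Finset.sum_congr rfl fun k hk => ?_
  rw [h1, if_pos hk]
  ring

lemma sum_sum_yTilde (Y : Matrix (Fin n) (Fin n) ℝ) (hς : ς = 1 ∨ ς = -1)
    (hI : largeSet u α = largeSet v α)
    (hsign : ∀ k ∈ largeSet v α, Real.sign (u k) = ς * Real.sign (v k)) :
    ∑ j ∈ largeSet u α, ∑ k ∈ largeSet u α, yTilde Y u α j k =
      signVec v α ⬝ᵥ (Y *ᵥ signVec v α) := by
  have hςς : ς * ς = 1 := by rcases hς with rfl | rfl <;> norm_num
  have h : signVec v α ⬝ᵥ (Y *ᵥ signVec v α) =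
      ∑ j ∈ largeSet v α, Real.sign (v j) * (Y *ᵥ signVec v α) j := by
    simp [dotProduct, signVec, Finset.sum_ite_mem]
  rw [h]
  refine Finset.sum_congr hI fun j hj => ?_
  rw [sum_yTilde Y hI hsign, if_pos hj]
  linear_combination (Real.sign (v j) * (Y *ᵥ signVec v α) j) * hςς

lemma sum_sq_yTilde (Y : Matrix (Fin n) (Fin n) ℝ) (hα : 0 < α) (hς : ς = 1 ∨ ς = -1)
    (hI : largeSet u α = largeSet v α)
    (hsign : ∀ k ∈ largeSet v α, Real.sign (u k) = ς * Real.sign (v k)) :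
    ∑ j, (∑ k ∈ largeSet u α, yTilde Y u α j k) ^ 2 = nrm (Y *ᵥ signVec v α) ^ 2 := by
  have hςς : ς * ς = 1 := by rcases hς with rfl | rfl <;> norm_num
  rw [nrm_sq]
  refine Finset.sum_congr rfl fun j _ => ?_
  rw [sum_yTilde Y hI hsign]
  have h : (if j ∈ largeSet v α then ς * Real.sign (v j) else 1) ^ 2 = 1 := by
    split_ifs with hj
    · rw [mul_pow, sq, sq, hςς, sign_mul_self_of_ne_zero (ne_zero_of_mem_largeSet hα hj), one_mul]
    · simp
  rw [mul_pow, h, mul_pow, sq ς, hςς, one_mul, one_mul]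

/-- Here `z`, `b`, `d` stand for `qᵀAq`, `vᵀAq` and the centred `‖Aq‖²`. The main terms cancel
exactly, and the denominator keeps at least half its main term. -/
lemma abs_ratio_sub_le {l a b d z B D Z : ℝ} (hl : 0 < l) (ha : 0 < a) (hb : |b| ≤ B)
    (hd : |d| ≤ D) (hz : |z| ≤ Z) (hZ : 2 * Z ≤ l * a ^ 2) :
    0 < l * a ^ 2 + z ∧
      |(l ^ 2 * a ^ 2 + 2 * l * a * b + d) / (l * a ^ 2 + z) - l| ≤
        4 * (B / a) + 2 * (D / (l * a ^ 2)) + 2 * (Z / a ^ 2) := by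
  have hla : 0 < l * a ^ 2 := by positivity
  have hden : l * a ^ 2 / 2 ≤ l * a ^ 2 + z := by linarith [(abs_le.1 hz).1]
  have hden0 : 0 < l * a ^ 2 + z := by linarith
  refine ⟨hden0, ?_⟩
  have h1 : (l ^ 2 * a ^ 2 + 2 * l * a * b + d) / (l * a ^ 2 + z) - l =
      (2 * l * a * b + d - l * z) / (l * a ^ 2 + z) := by
    field_simp
    ring
  rw [h1, abs_div, abs_of_pos hden0]
  have hnum : |2 * l * a * b + d - l * z| ≤ 2 * l * a * B + D + l * Z := by
    refine (abs_sub _ _).trans (add_le_add ((abs_add_le _ _).trans (add_le_add ?_ hd)) ?_)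
    · rw [abs_mul, abs_of_pos (by positivity : 0 < 2 * l * a)]; gcongr
    · rw [abs_mul, abs_of_pos hl]; gcongr
  have hnum0 : 0 ≤ 2 * l * a * B + D + l * Z := (abs_nonneg _).trans hnum
  calc |2 * l * a * b + d - l * z| / (l * a ^ 2 + z)
      ≤ (2 * l * a * B + D + l * Z) / (l * a ^ 2 / 2) := by gcongr
    _ = 4 * (B / a) + 2 * (D / (l * a ^ 2)) + 2 * (Z / a ^ 2) := by
        field_simp
        ring

lemma nrm_smul_add_sq (c : ℝ) {v : Fin n → ℝ} (hv : nrm v = 1) (x : Fin n → ℝ) :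
    nrm (c • v + x) ^ 2 = c ^ 2 + 2 * c * (v ⬝ᵥ x) + nrm x ^ 2 := by
  rw [← dotProduct_self_eq, add_dotProduct, dotProduct_add, dotProduct_add, smul_dotProduct,
    smul_dotProduct, dotProduct_smul, dotProduct_smul, dotProduct_self_eq, dotProduct_self_eq, hv,
    dotProduct_comm x v]
  simp only [smul_eq_mul]
  ring

/-- Error bound for the estimator once the support and the signs have been recovered. -/
lemma abs_lambdaHat_sub_le {A : Matrix (Fin n) (Fin n) ℝ} {l σ ν L : ℝ} (hν : 0 ≤ ν) (hl : 0 < l)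
    (hv : nrm v = 1) (hα : 0 < α) (hς : ς = 1 ∨ ς = -1) (hI : largeSet u α = largeSet v α)
    (hsign : ∀ k ∈ largeSet v α, Real.sign (u k) = ς * Real.sign (v k)) (hL : 1 ≤ L)
    (hcard : 1 / (α ^ 2 * L ^ 2) ≤ ((largeSet v α).card : ℝ))
    (hz : |signVec v α ⬝ᵥ (A *ᵥ signVec v α)| ≤
      7 * (largeSet v α).card * Real.sqrt (ν * L))
    (hb : |v ⬝ᵥ (A *ᵥ signVec v α)| ≤ 7 * Real.sqrt (ν * (largeSet v α).card * L))
    (hd : |nrm (A *ᵥ signVec v α) ^ 2 - (largeSet v α).card * n * σ ^ 2| ≤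
      546 * ν * (largeSet v α).card * Real.sqrt n * L)
    (hlν : Real.sqrt (ν * n * L) ≤ l) (hn : 14 * L ^ 2 ≤ Real.sqrt n) :
    0 < sHat (l • Matrix.vecMulVec v v + A) u α ∧
      |lambdaHat (l • Matrix.vecMulVec v v + A) σ u α - l| ≤
        1134 * (Real.sqrt ν * (L ^ 2 * Real.sqrt L)) := by
  set m : ℝ := ((largeSet v α).card : ℝ) with hm
  set q := signVec v α with hq
  set a := v ⬝ᵥ q with ha
  have hL0 : 0 < L := by linarith
  have hm0 : 0 < m := lt_of_lt_of_le (by positivity) hcard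
  have hma : m * α ≤ a := card_mul_le_dotProduct_signVec v α
  have ha0 : 0 < a := lt_of_lt_of_le (by positivity) hma
  -- The only use of the cardinality condition beyond `m > 0`; it converts each noise term, measured
  -- in `m`, into units of `a²`.
  have haL : m ≤ a ^ 2 * L ^ 2 := by
    have h1 : 1 ≤ m * (α ^ 2 * L ^ 2) := by rwa [div_le_iff₀ (by positivity)] at hcard
    have h2 : (m * α) ^ 2 ≤ a ^ 2 := by gcongr
    calc m ≤ m * (m * (α ^ 2 * L ^ 2)) := le_mul_of_one_le_right hm0.le h1
      _ = (m * α) ^ 2 * L ^ 2 := by ring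
      _ ≤ a ^ 2 * L ^ 2 := by gcongr
  have hsqrtL : 1 ≤ Real.sqrt L := Real.one_le_sqrt.2 hL
  have hs1 : Real.sqrt (ν * L) = Real.sqrt ν * Real.sqrt L := Real.sqrt_mul hν _
  have hs2 : Real.sqrt (ν * m * L) = Real.sqrt ν * Real.sqrt m * Real.sqrt L := by
    rw [Real.sqrt_mul (by positivity), Real.sqrt_mul hν]
  have hs3 : Real.sqrt (ν * n * L) = Real.sqrt ν * Real.sqrt n * Real.sqrt L := by
    rw [Real.sqrt_mul (by positivity), Real.sqrt_mul hν]
  rw [hs1] at hz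
  rw [hs2] at hb
  rw [hs3] at hlν
  have hνs : Real.sqrt ν * Real.sqrt ν = ν := Real.mul_self_sqrt hν
  have hms : Real.sqrt m ≤ a * L := by
    rw [Real.sqrt_le_left (by positivity), mul_pow]; exact haL
  have hZ : 2 * (7 * m * (Real.sqrt ν * Real.sqrt L)) ≤ l * a ^ 2 := by
    have h1 : 14 * L ^ 2 * (Real.sqrt ν * Real.sqrt L) ≤ l := by
      calc 14 * L ^ 2 * (Real.sqrt ν * Real.sqrt L)
          ≤ Real.sqrt n * (Real.sqrt ν * Real.sqrt L) := by gcongr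
        _ = Real.sqrt ν * Real.sqrt n * Real.sqrt L := by ring
        _ ≤ l := hlν
    calc 2 * (7 * m * (Real.sqrt ν * Real.sqrt L))
        ≤ 2 * (7 * (a ^ 2 * L ^ 2) * (Real.sqrt ν * Real.sqrt L)) := by gcongr
      _ = 14 * L ^ 2 * (Real.sqrt ν * Real.sqrt L) * a ^ 2 := by ring
      _ ≤ l * a ^ 2 := by gcongr
  obtain ⟨hden, hratio⟩ := abs_ratio_sub_le hl ha0 hb hd hz hZ
  have hYq : (l • Matrix.vecMulVec v v + A) *ᵥ q = (l * a) • v + A *ᵥ q := spike_mulVec _ _ _ _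
  have hS : ∑ j ∈ largeSet u α, ∑ k ∈ largeSet u α,
      yTilde (l • Matrix.vecMulVec v v + A) u α j k = l * a ^ 2 + q ⬝ᵥ (A *ᵥ q) := by
    rw [sum_sum_yTilde _ hς hI hsign, ← hq, hYq, dotProduct_add, dotProduct_smul,
      dotProduct_comm q v, smul_eq_mul, ← ha]
    ring
  have hNum : ∑ j, (∑ k ∈ largeSet u α, yTilde (l • Matrix.vecMulVec v v + A) u α j k) ^ 2 =
      l ^ 2 * a ^ 2 + 2 * l * a * (v ⬝ᵥ (A *ᵥ q)) + nrm (A *ᵥ q) ^ 2 := by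
    rw [sum_sq_yTilde _ hα hς hI hsign, ← hq, hYq, nrm_smul_add_sq _ hv]
    ring
  refine ⟨?_, ?_⟩
  · rw [sHat, hS]; exact Real.sqrt_pos.2 hden
  · rw [lambdaHat, sHat, hS, Real.sq_sqrt hden.le, hNum, hI, ← hm]
    have e1 : l ^ 2 * a ^ 2 + 2 * l * a * (v ⬝ᵥ (A *ᵥ q)) + nrm (A *ᵥ q) ^ 2 - m * n * σ ^ 2 =
      l ^ 2 * a ^ 2 + 2 * l * a * (v ⬝ᵥ (A *ᵥ q)) + (nrm (A *ᵥ q) ^ 2 - m * n * σ ^ 2) := by ring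
    rw [e1]
    refine hratio.trans ?_
    -- Each of the three errors is a multiple of `R`, and `4 · 7 + 2 · 546 + 2 · 7 = 1134`.
    set R := Real.sqrt ν * (L ^ 2 * Real.sqrt L) with hR
    have f1 : 7 * (Real.sqrt ν * Real.sqrt m * Real.sqrt L) / a ≤ 7 * R := by
      rw [div_le_iff₀ ha0]
      calc 7 * (Real.sqrt ν * Real.sqrt m * Real.sqrt L)
          ≤ 7 * (Real.sqrt ν * (a * L) * Real.sqrt L) := by gcongr
        _ = 7 * (Real.sqrt ν * (L * Real.sqrt L)) * a := by ring
        _ ≤ 7 * (Real.sqrt ν * (L ^ 2 * Real.sqrt L)) * a := by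
            gcongr; nlinarith
    have f2 : 546 * ν * m * Real.sqrt n * L / (l * a ^ 2) ≤ 546 * R := by
      rw [div_le_iff₀ (by positivity)]
      have hLs : L = Real.sqrt L * Real.sqrt L := (Real.mul_self_sqrt hL0.le).symm
      calc 546 * ν * m * Real.sqrt n * L
          ≤ 546 * ν * (a ^ 2 * L ^ 2) * Real.sqrt n * L := by gcongr
        _ = 546 * (Real.sqrt ν * (L ^ 2 * Real.sqrt L)) *
            ((Real.sqrt ν * Real.sqrt n * Real.sqrt L) * a ^ 2) := by
            nth_rewrite 1 [← hνs]
            nth_rewrite 2 [hLs]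
            ring
        _ ≤ 546 * R * (l * a ^ 2) := by gcongr
    have f3 : 7 * m * (Real.sqrt ν * Real.sqrt L) / a ^ 2 ≤ 7 * R := by
      rw [div_le_iff₀ (by positivity)]
      calc 7 * m * (Real.sqrt ν * Real.sqrt L)
          ≤ 7 * (a ^ 2 * L ^ 2) * (Real.sqrt ν * Real.sqrt L) := by gcongr
        _ = 7 * R * a ^ 2 := by rw [hR]; ring
    linarith

end Estimator

/-! ### Success of the algorithm on tame noise. -/

section Tame

variable {n : ℕ}

/-- The deterministic properties of the noise matrix, relative to the signal direction `v`, that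
the analysis of the estimator relies on. -/
structure TameNoise (A : Matrix (Fin n) (Fin n) ℝ) (v : Fin n → ℝ) (σ ν L : ℝ) : Prop where
  op : OpBound A (20 * Real.sqrt (ν * n))
  row : ∀ i, ∀ t < n, |(A *ᵥ (compress i A ^ t *ᵥ v)) i| ≤
    7 * Real.sqrt (ν * L) * (20 * Real.sqrt (ν * n)) ^ t
  quad : ∀ i, v i ≠ 0 → |signVec v |v i| ⬝ᵥ (A *ᵥ signVec v |v i|)| ≤
    7 * (largeSet v |v i|).card * Real.sqrt (ν * L)
  cross : ∀ i, v i ≠ 0 → |v ⬝ᵥ (A *ᵥ signVec v |v i|)| ≤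
    7 * Real.sqrt (ν * (largeSet v |v i|).card * L)
  sqNorm : ∀ i, v i ≠ 0 →
    |nrm (A *ᵥ signVec v |v i|) ^ 2 - (largeSet v |v i|).card * n * σ ^ 2| ≤
      546 * ν * (largeSet v |v i|).card * Real.sqrt n * L

lemma TameNoise.smul {A : Matrix (Fin n) (Fin n) ℝ} {v : Fin n → ℝ} {σ ν L s : ℝ}
    (h : TameNoise A v σ ν L) (hs : |s| = 1) : TameNoise (s • A) v σ ν L where
  op := opBound_smul h.op hs
  row i t ht := by
    have hc : compress i (s • A) = s • compress i A := by
      ext a b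
      simp [compress]
    rw [hc, smul_pow, Matrix.smul_mulVec, Matrix.smul_mulVec, Matrix.mulVec_smul, Pi.smul_apply,
      Pi.smul_apply, smul_eq_mul, smul_eq_mul, abs_mul, abs_mul, abs_pow, hs, one_pow, one_mul,
      one_mul]
    exact h.row i t ht
  quad i hi := by
    rw [Matrix.smul_mulVec, dotProduct_smul, smul_eq_mul, abs_mul, hs, one_mul]
    exact h.quad i hi
  cross i hi := by
    rw [Matrix.smul_mulVec, dotProduct_smul, smul_eq_mul, abs_mul, hs, one_mul]
    exact h.cross i hi
  sqNorm i hi := by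
    rw [Matrix.smul_mulVec, nrm_smul, hs, one_mul]
    exact h.sqNorm i hi

/-- Raise the threshold to the smallest modulus it selects. This is why `TameNoise` asks for control
only at the levels `|v i|`. -/
lemma exists_largeSet_eq {v : Fin n → ℝ} {α : ℝ} (hα : 0 < α) (hne : (largeSet v α).Nonempty) :
    ∃ i, v i ≠ 0 ∧ largeSet v α = largeSet v |v i| := by
  obtain ⟨i, hi, hmin⟩ := Finset.exists_min_image _ (fun k => |v k|) hne
  refine ⟨i, ne_zero_of_mem_largeSet hα hi, ?_⟩
  ext k
  refine ⟨fun hk => mem_largeSet.2 (hmin k hk), fun hk => ?_⟩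
  exact mem_largeSet.2 ((mem_largeSet.1 hi).trans (mem_largeSet.1 hk))

lemma signVec_congr {v : Fin n → ℝ} {α β : ℝ} (h : largeSet v α = largeSet v β) :
    signVec v α = signVec v β := by
  unfold signVec
  rw [h]

/-- The top eigenvector is entrywise close to the signal, up to a sign. -/
lemma TameNoise.exists_sign_close {A : Matrix (Fin n) (Fin n) ℝ} {u v : Fin n → ℝ}
    {σ ν L l ε₀ C₁ : ℝ} (hA : TameNoise A v σ ν L) (hsymm : A.IsSymm) (hν : 0 ≤ ν)
    (hε : 0 < ε₀) (hε1 : ε₀ ≤ 1) (hC : 2400 / ε₀ < C₁) (hv : nrm v = 1)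
    (hl : 0 < l) (hlν : C₁ * Real.sqrt (ν * n * L) ≤ l) (hn : 1 ≤ n) (hL : (20 / ε₀) ^ 2 ≤ L)
    (hu : IsTopEigenvector (l • Matrix.vecMulVec v v + A) u) :
    ∃ ς : ℝ, (ς = 1 ∨ ς = -1) ∧ ∀ α : ℝ, 0 < α → 1 ≤ 2 * n * α ^ 2 →
      ∀ i, |u i - ς * v i| ≤ ε₀ / 50 * (|v i| + α) := by
  obtain ⟨hu1, θ, hθu, hθ⟩ := hu
  set M := 20 * Real.sqrt (ν * n) with hM
  have hn' : (1 : ℝ) ≤ n := by exact_mod_cast hn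
  have hM0 : 0 ≤ M := by positivity
  have hL0 : 0 < L := lt_of_lt_of_le (by positivity) hL
  have hsL : 20 / ε₀ ≤ Real.sqrt L := Real.le_sqrt_of_sq_le hL
  have hC0 : 0 < C₁ := lt_trans (by positivity) hC
  have hCε : 2400 ≤ ε₀ * C₁ := by
    have := (div_lt_iff₀ hε).1 hC
    linarith
  have hs3 : Real.sqrt (ν * n * L) = Real.sqrt (ν * n) * Real.sqrt L :=
    Real.sqrt_mul (by positivity) _
  have hs4 : Real.sqrt (ν * n * L) = Real.sqrt (ν * L) * Real.sqrt n := by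
    rw [mul_right_comm, Real.sqrt_mul (by positivity)]
  have hMl : M ≤ ε₀ / 2400 * l := by
    have h1 : C₁ * (Real.sqrt (ν * n) * (20 / ε₀)) ≤ l := by
      refine le_trans ?_ hlν
      rw [hs3]
      gcongr
    have h2 : 2400 / ε₀ * (Real.sqrt (ν * n) * (20 / ε₀)) ≤ l := le_trans (by gcongr) h1
    have h3 : ε₀ / 2400 * (2400 / ε₀ * (Real.sqrt (ν * n) * (20 / ε₀))) ≤ ε₀ / 2400 * l := by
      gcongr
    have h4 : ε₀ / 2400 * (2400 / ε₀ * (Real.sqrt (ν * n) * (20 / ε₀))) = M / ε₀ := by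
      rw [hM]; field_simp
    rw [h4] at h3
    refine le_trans ?_ h3
    rw [le_div_iff₀ hε]
    nlinarith
  have hθl : l - M ≤ θ := top_eigenvalue_ge hsymm hA.op hv hθ
  have hθ99 : 99 / 100 * l ≤ θ := by nlinarith
  have hθ0 : 0 < θ := by linarith
  set h := ε₀ / 2000 with hh
  have hsn : 0 < Real.sqrt n := Real.sqrt_pos.2 (by linarith)
  -- `C₁ > 2400 / ε₀` is what lets `ρ θ` dominate the row bound: `7 ≤ 2400 · 99 / 30000`.
  set ρ := ε₀ / (300 * Real.sqrt n) with hρ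
  have hρ0 : 0 ≤ ρ := by positivity
  have hτρ : 7 * Real.sqrt (ν * L) ≤ ρ * θ := by
    have h1 : ρ * (99 / 100 * (C₁ * Real.sqrt (ν * n * L))) ≤ ρ * θ := by
      gcongr
      linarith
    refine le_trans ?_ h1
    have h2 : ρ * (99 / 100 * (C₁ * Real.sqrt (ν * n * L))) =
        (ε₀ * C₁) * (99 / 30000) * Real.sqrt (ν * L) := by
      rw [hs4, hρ]; field_simp; ring
    rw [h2]
    gcongr
    linarith
  -- Truncating at `T = n` makes the remainder at most `2 ^ (-n)`, well below `1 / √n`, while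
  -- keeping only `n` powers per row in the union bound.
  obtain ⟨ς, hς, hclose⟩ := exists_sign_abs_sub_le (T := n) (a := l * (v ⬝ᵥ u)) (h := h) (ρ := ρ)
    hA.op hM0 hθ0 (nrm_eq_one hu1) hv (by rw [← hθu, spike_mulVec]) hn hA.row
    (by rw [hh]; nlinarith) (by rw [hh]; linarith) hτρ
  refine ⟨ς, hς, fun α hα hnα i => (hclose i).trans ?_⟩
  have hα' : 1 / Real.sqrt n ≤ 3 / 2 * α := by
    rw [div_le_iff₀ hsn]
    have h1 : (1 : ℝ) ^ 2 ≤ (3 / 2 * α * Real.sqrt n) ^ 2 := by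
      rw [mul_pow, Real.sq_sqrt (by linarith)]
      nlinarith
    simpa using (sq_le_sq₀ zero_le_one (by positivity)).1 h1
  have h1 : 2 * ρ ≤ ε₀ / 100 * α := by
    have : 2 * ρ = ε₀ / 150 * (1 / Real.sqrt n) := by rw [hρ]; field_simp; norm_num
    rw [this]
    calc ε₀ / 150 * (1 / Real.sqrt n) ≤ ε₀ / 150 * (3 / 2 * α) := by gcongr
      _ = ε₀ / 100 * α := by ring
  have h2 : h ^ n ≤ 1 / Real.sqrt n := by
    have h3 : h ^ n ≤ (1 / 2 : ℝ) ^ n := by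
      gcongr
      linarith
    have h4 : (n : ℝ) ≤ 2 ^ n := by exact_mod_cast Nat.lt_two_pow_self.le
    have h5 : (1 / 2 : ℝ) ^ n ≤ 1 / n := by
      rw [div_pow, one_pow]
      exact one_div_le_one_div_of_le (by linarith) h4
    have h6 : 1 / (n : ℝ) ≤ 1 / Real.sqrt n := by
      refine one_div_le_one_div_of_le hsn ?_
      rw [Real.sqrt_le_left (by linarith)]
      nlinarith
    exact h3.trans (h5.trans h6)
  have h3 : 2 * h * h ^ n ≤ ε₀ / 1000 * (3 / 2 * α) := by
    have : 2 * h = ε₀ / 1000 := by rw [hh]; ring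
    rw [this]
    gcongr
    exact h2.trans hα'
  have h4 : 0 ≤ ε₀ * |v i| := by positivity
  have h5 : 0 < ε₀ * α := by positivity
  have h6 : 2 * h * |v i| = ε₀ * |v i| / 1000 := by rw [hh]; ring
  rw [h6]
  nlinarith

/-- On tame noise the algorithm succeeds. -/
lemma TameNoise.goodOutcome {W : Matrix (Fin n) (Fin n) ℝ} {v : Fin n → ℝ}
    {σ ν lam ε₀ C₁ : ℝ} (hW : TameNoise W v σ ν (Real.log n)) (hsymm : W.IsSymm) (hν : 0 ≤ ν)
    (hε : 0 < ε₀) (hε1 : ε₀ ≤ 1) (hC : 2400 / ε₀ < C₁) (hv : ∑ i, v i ^ 2 = 1)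
    (hlam : lam ≠ 0) (hlν : C₁ * Real.sqrt (ν * n * Real.log n) ≤ |lam|)
    (hgap : HasGap v ε₀) (hL : (20 / ε₀) ^ 2 ≤ Real.log n)
    (hnL : 14 * Real.log n ^ 2 ≤ Real.sqrt n) :
    GoodOutcome (lam • Matrix.vecMulVec v v + W) lam σ (ε₀ / 2)
      (1134 * Real.sqrt ν * Real.log n ^ (5 / 2 : ℝ)) := by
  intro lam₀ hlam₀ u hu
  replace hv := nrm_eq_one hv
  have hε20 : 20 ≤ 20 / ε₀ := by rw [le_div_iff₀ hε]; linarith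
  have hL1 : 1 < Real.log n := by nlinarith
  have hn : 1 ≤ n := by
    rcases Nat.eq_zero_or_pos n with rfl | h
    · simp at hL1; linarith
    · exact h
  have hC1 : 2400 ≤ C₁ := by
    have : 2400 ≤ 2400 / ε₀ := by rw [le_div_iff₀ hε]; linarith
    linarith
  have hlam0 : 0 < |lam| := abs_pos.2 hlam
  have hM : 2 * (20 * Real.sqrt (ν * n)) < |lam| := by
    have h1 : Real.sqrt (ν * n) ≤ Real.sqrt (ν * n * Real.log n) :=
      Real.sqrt_le_sqrt (le_mul_of_one_le_right (by positivity) hL1.le)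
    have h2 : 2400 * Real.sqrt (ν * n * Real.log n) ≤ C₁ * Real.sqrt (ν * n * Real.log n) := by
      gcongr
    linarith [Real.sqrt_nonneg (ν * n)]
  have hpos : 0 < lam₀ * lam := by
    rcases hlam₀ with h | h
    · exact h
    · exact leading_eigenvalue_sign hsymm hW.op hv hM (by positivity) h
  set s := orientation lam₀ with hs
  have hs' : (s = 1 ∨ s = -1) ∧ s * lam = |lam| := by
    rcases lt_or_gt_of_ne hlam with h | h
    · have h0 : lam₀ < 0 := by nlinarith
      simp [hs, orientation, h0, abs_of_neg h]
    · have h0 : ¬ lam₀ < 0 := by nlinarith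
      simp [hs, orientation, h0, abs_of_pos h]
  obtain ⟨hs1, hsl⟩ := hs'
  have hss : s * s = 1 := by rcases hs1 with h | h <;> rw [h] <;> norm_num
  have habs : |s| = 1 := by rcases hs1 with h | h <;> rw [h] <;> norm_num
  have hsY : s • (lam • Matrix.vecMulVec v v + W) = |lam| • Matrix.vecMulVec v v + s • W := by
    rw [smul_add, smul_smul, hsl]
  rw [hsY] at hu ⊢
  have hA := hW.smul habs
  obtain ⟨ς, hς, hclose⟩ := hA.exists_sign_close (hsymm.smul s) hν hε hε1 hC hv hlam0 hlν hn hL hu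
  refine ⟨?_, fun α hadm => ?_⟩
  · obtain ⟨α, hα, -, hcard, hempty⟩ := hgap
    obtain ⟨hα0, hnα⟩ := grid_lower_bound hL1 hα
    exact ⟨α, isAdmissible_of_close hε hε1 hα0 hς (hclose α hα0 hnα) hα hcard hempty⟩
  · obtain ⟨hα, hcard, hempty⟩ := hadm
    obtain ⟨hα0, hnα⟩ := grid_lower_bound hL1 hα
    have hcl := hclose α hα0 hnα
    have hI := largeSet_eq_of_close hε hε1 hα0 hς hcl hempty
    rw [hI] at hcard
    have hcard0 : (0 : ℝ) < (largeSet v α).card := lt_of_lt_of_le (by positivity) hcard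
    have hne : (largeSet v α).Nonempty := Finset.card_pos.1 (by exact_mod_cast hcard0)
    obtain ⟨i, hi, hIi⟩ := exists_largeSet_eq hα0 hne
    have hq := signVec_congr hIi
    have h1 := hA.quad i hi
    have h2 := hA.cross i hi
    have h3 := hA.sqNorm i hi
    rw [← hq, ← hIi] at h1 h2 h3
    obtain ⟨r1, r2⟩ := abs_lambdaHat_sub_le hν hlam0 hv hα0 hς hI
      (fun k hk => sign_eq_of_close hε1 hα0 hς hcl hk) hL1.le hcard h1 h2 h3
      (le_trans (le_mul_of_one_le_left (Real.sqrt_nonneg _) (by linarith)) hlν) hnL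
    refine ⟨r1, ?_⟩
    have e1 : ∀ x, s * x - lam = s * (x - |lam|) := fun x => by
      rw [← hsl]; linear_combination lam * hss
    rw [e1, abs_mul, habs, one_mul]
    refine r2.trans (le_of_eq ?_)
    have e2 : Real.log n ^ (5 / 2 : ℝ) = Real.log n ^ 2 * Real.sqrt (Real.log n) := by
      rw [Real.sqrt_eq_rpow, ← Real.rpow_natCast, ← Real.rpow_add (by linarith)]
      norm_num
    rw [e2]
    ring

end Tame

/-! ### Probability of tame noise and the final numerics. -/

section Probability

variable {n : ℕ}

/-- The tail bounds divide by `ν`, so `ν = 0` is separate: the noise and its variance vanish, and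
every inequality reads `0 ≤ 0`. -/
lemma IsNoise.measure_not_tame_of_zero {Ω : Type*} [MeasurableSpace Ω] {μ : Measure Ω}
    {W : Ω → Matrix (Fin n) (Fin n) ℝ} {σ : ℝ} {v : Fin n → ℝ} {L : ℝ} (hW : IsNoise μ W σ 0) :
    μ {ω | ¬ TameNoise (W ω) v σ (0 : ℝ≥0) L} = 0 := by
  have hae : ∀ᵐ ω ∂μ, ∀ i j, W ω i j = 0 := by
    rw [ae_all_iff]; intro i
    rw [ae_all_iff]; intro j
    exact (hW.subgaussian i j).ae_eq_zero_of_hasSubgaussianMGF_zero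
  change ∀ᵐ ω ∂μ, TameNoise (W ω) v σ (0 : ℝ≥0) L
  filter_upwards [hae] with ω hω
  have hW0 : W ω = 0 := by ext i j; exact hω i j
  have hn0 : nrm (0 : Fin n → ℝ) = 0 := nrm_eq_zero.2 rfl
  have hσ : ∀ _i : Fin n, σ ^ 2 = 0 := fun i => by
    rw [← hW.variance_eq i i,
      variance_congr (hW.subgaussian i i).ae_eq_zero_of_hasSubgaussianMGF_zero, variance_zero]
  rw [hW0]
  refine ⟨fun x => ?_, fun i t _ => ?_, fun i _ => ?_, fun i _ => ?_, fun i _ => ?_⟩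
  · simp [hn0]
  · simp
  · simp
  · simp
  · simp [hn0, hσ i]

variable {Ω : Type*} [MeasurableSpace Ω] {μ : Measure Ω} [IsProbabilityMeasure μ]
  {W : Ω → Matrix (Fin n) (Fin n) ℝ} {σ : ℝ} {ν : ℝ≥0} {v : Fin n → ℝ} {L : ℝ}

lemma IsNoise.measure_not_tame_of_pos (hW : IsNoise μ W σ ν) (hν : 0 < ν) (hn : 1 ≤ n)
    (hv : nrm v = 1) (hL : 1 ≤ L) :
    μ {ω | ¬ TameNoise (W ω) v σ ν L} ≤
      ENNReal.ofReal (2 * Real.exp (-3 * n) +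
        (n ^ 2 + n * (n ^ 2 + 4)) * (2 * Real.exp (-(12 * L)))) := by
  have hν' : (0 : ℝ) < ν := hν
  have hL0 : 0 < L := by linarith
  have hn' : (1 : ℝ) ≤ n := by exact_mod_cast hn
  set M := 20 * Real.sqrt (ν * n) with hM
  have hM0 : 0 < M := by positivity
  set p := 2 * Real.exp (-(12 * L)) with hp
  have hp0 : 0 < p := by positivity
  set q : Fin n → Fin n → ℝ := fun i => signVec v |v i| with hq
  set m : Fin n → ℝ := fun i => ((largeSet v |v i|).card : ℝ) with hm
  set R : Fin n × Fin n → Set Ω := fun x => {ω | OpBound (W ω) M ∧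
    7 * Real.sqrt (ν * L) * M ^ (x.2 : ℕ) <
      |(W ω *ᵥ (compress x.1 (W ω) ^ (x.2 : ℕ) *ᵥ v)) x.1|} with hR
  set Q : Fin n → Set Ω := fun i => {ω | v i ≠ 0 ∧
    (7 * m i * Real.sqrt (ν * L) ≤ |q i ⬝ᵥ (W ω *ᵥ q i)| ∨
      7 * Real.sqrt (ν * m i * L) ≤ |v ⬝ᵥ (W ω *ᵥ q i)| ∨
      546 * ν * m i * Real.sqrt n * L < |nrm (W ω *ᵥ q i) ^ 2 - m i * n * σ ^ 2|)} with hQ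
  have hsub : {ω | ¬ TameNoise (W ω) v σ ν L} ⊆ {ω | ¬ OpBound (W ω) M} ∪
      ((⋃ x ∈ (Finset.univ : Finset (Fin n × Fin n)), R x) ∪
        ⋃ i ∈ (Finset.univ : Finset (Fin n)), Q i) := by
    intro ω hω
    by_contra hcon
    simp only [Set.mem_union, Set.mem_iUnion, Finset.mem_univ, exists_const, not_or, not_exists,
      hR, hQ, Set.mem_ofPred_eq, not_not, not_and, not_lt, not_le] at hcon
    obtain ⟨c1, c2, c3⟩ := hcon
    exact hω ⟨c1, fun i t ht => c2 (i, ⟨t, ht⟩) c1, fun i hi => (c3 i hi).1.le,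
      fun i hi => (c3 i hi).2.1.le, fun i hi => (c3 i hi).2.2⟩
  have hRle : ∀ x, μ (R x) ≤ ENNReal.ofReal p := fun x =>
    hW.measure_row_abs_gt_le hν hv hM0 hL x.1 x.2
  have hQle : ∀ i, μ (Q i) ≤ ENNReal.ofReal ((n ^ 2 + 4) * p) := by
    intro i
    by_cases hi : v i = 0
    · have : Q i = ∅ := by simp [hQ, hi]
      rw [this]; simp
    have hnq : nrm (q i) ^ 2 = m i := nrm_signVec_sq v (abs_pos.2 hi)
    have hm1 : 1 ≤ m i := by
      have : 0 < (largeSet v |v i|).card := Finset.card_pos.2 ⟨i, mem_largeSet.2 le_rfl⟩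
      simp only [hm]
      exact_mod_cast this
    have hm0 : 0 < m i := by linarith
    have b1 : μ {ω | 7 * m i * Real.sqrt (ν * L) ≤ |q i ⬝ᵥ (W ω *ᵥ q i)|} ≤ ENNReal.ofReal p := by
      refine (hW.measure_bilin_abs_ge_le hν (q i) (q i) (V := m i ^ 2) (by positivity)
        (by positivity) (le_of_eq (by rw [hnq]; ring))).trans (ENNReal.ofReal_le_ofReal ?_)
      rw [hp]
      gcongr
      rw [mul_pow, Real.sq_sqrt (by positivity)]
      have : (7 * m i) ^ 2 * (ν * L) / (4 * ν * m i ^ 2) = 49 / 4 * L := by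
        field_simp; norm_num
      rw [this]
      linarith
    have b2 : μ {ω | 7 * Real.sqrt (ν * m i * L) ≤ |v ⬝ᵥ (W ω *ᵥ q i)|} ≤ ENNReal.ofReal p := by
      refine (hW.measure_bilin_abs_ge_le hν v (q i) (V := m i) (by positivity)
        (by positivity) (le_of_eq (by rw [hnq, hv]; ring))).trans (ENNReal.ofReal_le_ofReal ?_)
      rw [hp]
      gcongr
      rw [mul_pow, Real.sq_sqrt (by positivity)]
      have : 7 ^ 2 * (ν * m i * L) / (4 * ν * m i) = 49 / 4 * L := by
        field_simp; norm_num
      rw [this]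
      linarith
    have b3 : μ {ω | 546 * ν * m i * Real.sqrt n * L <
        |nrm (W ω *ᵥ q i) ^ 2 - m i * n * σ ^ 2|} ≤ ENNReal.ofReal ((n ^ 2 + 2) * p) := by
      have := hW.measure_nrm_sq_abs_gt_le hν hn (abs_signVec_le v |v i|)
        (by rw [nrm_signVec_sq v (abs_pos.2 hi)]; exact hm1) hL
      rwa [nrm_signVec_sq v (abs_pos.2 hi)] at this
    have hsplit : ENNReal.ofReal ((n ^ 2 + 4) * p) =
        ENNReal.ofReal p + (ENNReal.ofReal p + ENNReal.ofReal ((n ^ 2 + 2) * p)) := by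
      rw [← ENNReal.ofReal_add (by positivity) (by positivity),
        ← ENNReal.ofReal_add (by positivity) (by positivity)]
      congr 1
      ring
    rw [hsplit]
    refine (measure_mono ?_).trans ((measure_union_le _ _).trans
      (add_le_add b1 ((measure_union_le _ _).trans (add_le_add b2 b3))))
    rintro ω ⟨-, h⟩
    exact h
  refine (measure_mono hsub).trans ((measure_union_le _ _).trans
    ((add_le_add (hW.measure_not_opBound_le hν) ((measure_union_le _ _).trans
      (add_le_add
        ((measure_biUnion_finset_le _ _).trans (Finset.sum_le_sum fun x _ => hRle x))
        ((measure_biUnion_finset_le _ _).trans (Finset.sum_le_sum fun i _ => hQle i))))).trans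
          (le_of_eq ?_)))
  rw [Finset.sum_const, Finset.sum_const, Finset.card_univ, Finset.card_univ, Fintype.card_prod,
    Fintype.card_fin, nsmul_eq_mul, nsmul_eq_mul, ← ENNReal.ofReal_natCast,
    ← ENNReal.ofReal_natCast, ← ENNReal.ofReal_mul (by positivity),
    ← ENNReal.ofReal_mul (by positivity), ← ENNReal.ofReal_add (by positivity) (by positivity),
    ← ENNReal.ofReal_add (by positivity) (by positivity)]
  congr 1
  push_cast
  ring

end Probability

/-- At most `6 n⁴` events of probability `2 n⁻¹²`, plus the operator-norm failure, give `14 n⁻⁸`. -/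
lemma failure_bound_le {n : ℕ} (hn : 1 ≤ n) (hL : 1 ≤ Real.log n)
    (hnL : 14 * Real.log n ^ 2 ≤ Real.sqrt n) :
    2 * Real.exp (-3 * n) + (n ^ 2 + n * (n ^ 2 + 4)) * (2 * Real.exp (-(12 * Real.log n))) ≤
      14 * (n : ℝ) ^ (-8 : ℝ) * Real.log n := by
  have hn' : (1 : ℝ) ≤ n := by exact_mod_cast hn
  have hn0 : (0 : ℝ) < n := by linarith
  have hpow : (n : ℝ) ^ (-8 : ℝ) = Real.exp (-(8 * Real.log n)) := by
    rw [Real.rpow_def_of_pos hn0]; congr 1; ring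
  have hsn : Real.sqrt n ≤ n := by
    rw [Real.sqrt_le_left hn0.le]; nlinarith
  have h1 : Real.exp (-3 * n) ≤ Real.exp (-(8 * Real.log n)) := by
    refine Real.exp_le_exp.2 ?_
    nlinarith
  have h2 : (n : ℝ) ^ 4 * Real.exp (-(12 * Real.log n)) = Real.exp (-(8 * Real.log n)) := by
    nth_rewrite 1 [← Real.exp_log hn0]
    rw [← Real.exp_nat_mul, ← Real.exp_add]
    congr 1
    push_cast
    ring
  have h3 : (n : ℝ) ^ 2 + n * (n ^ 2 + 4) ≤ 6 * n ^ 4 := by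
    have e1 : (n : ℝ) ≤ n ^ 4 := le_self_pow₀ hn' (by norm_num)
    have e2 : (n : ℝ) ^ 2 ≤ n ^ 4 := pow_le_pow_right₀ hn' (by norm_num)
    have e3 : (n : ℝ) ^ 3 ≤ n ^ 4 := pow_le_pow_right₀ hn' (by norm_num)
    nlinarith
  rw [hpow]
  calc 2 * Real.exp (-3 * n) + (n ^ 2 + n * (n ^ 2 + 4)) * (2 * Real.exp (-(12 * Real.log n)))
      ≤ 2 * Real.exp (-(8 * Real.log n)) +
        6 * n ^ 4 * (2 * Real.exp (-(12 * Real.log n))) := by gcongr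
    _ = 14 * Real.exp (-(8 * Real.log n)) := by rw [← h2]; ring
    _ ≤ 14 * Real.exp (-(8 * Real.log n)) * Real.log n :=
        le_mul_of_one_le_right (by positivity) hL

lemma eventually_size_conditions (c : ℝ) : ∀ᶠ n : ℕ in Filter.atTop,
    1 ≤ n ∧ c ≤ Real.log n ∧ 14 * Real.log n ^ 2 ≤ Real.sqrt n := by
  have hcast := tendsto_natCast_atTop_atTop (R := ℝ)
  have h1 := (Real.tendsto_log_atTop.comp hcast).eventually_ge_atTop c
  have h2 := hcast.eventually ((Real.isLittleO_pow_log_id_atTop (n := 4)).bound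
    (show (0 : ℝ) < 1 / 196 by norm_num))
  filter_upwards [Filter.eventually_ge_atTop 1, h1, h2] with n hn h1 h2
  refine ⟨hn, h1, Real.le_sqrt_of_sq_le ?_⟩
  simp only [id, Real.norm_eq_abs, Nat.abs_cast] at h2
  have := (le_abs_self _).trans h2
  nlinarith

end SpikedWigner

end

theorem proposition1 :
    ∃ C : ℝ, 0 < C ∧ ∃ K : ℝ, 0 < K ∧
      ∀ ε₀ : ℝ, 0 < ε₀ → ε₀ ≤ 1 → ∀ C₁ : ℝ, 2400 / ε₀ < C₁ →
        ∃ N : ℕ, ∀ n : ℕ, N ≤ n →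
          ∀ (Ω : Type*) [MeasurableSpace Ω] (μ : MeasureTheory.Measure Ω)
            [MeasureTheory.IsProbabilityMeasure μ]
            (W : Ω → Matrix (Fin n) (Fin n) ℝ) (σ : ℝ) (ν : ℝ≥0)
            (lam : ℝ) (ustar : Fin n → ℝ),
            SpikedWigner.IsNoise μ W σ ν →
            lam ≠ 0 →
            ∑ i, ustar i ^ 2 = 1 →
            SpikedWigner.HasGap ustar ε₀ →
            C₁ * Real.sqrt ((ν : ℝ) * n * Real.log n) ≤ |lam| →
            μ {ω | ¬ SpikedWigner.GoodOutcome
                (lam • Matrix.vecMulVec ustar ustar + W ω) lam σ (ε₀ / 2)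
                (C * Real.sqrt (ν : ℝ) * Real.log n ^ (5 / 2 : ℝ))} ≤
              ENNReal.ofReal (K * (n : ℝ) ^ (-8 : ℝ) * Real.log n) := by
  refine ⟨1134, by norm_num, 14, by norm_num, fun ε₀ hε hε1 C₁ hC => ?_⟩
  obtain ⟨N, hN⟩ := Filter.eventually_atTop.1
    (SpikedWigner.eventually_size_conditions ((20 / ε₀) ^ 2))
  refine ⟨N, fun n hNn Ω _ μ _ W σ ν lam v hW hlam hv hgap hlν => ?_⟩
  obtain ⟨hn, hL, hnL⟩ := hN n hNn
  have hL1 : 1 ≤ Real.log n := by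
    have : 20 ≤ 20 / ε₀ := by rw [le_div_iff₀ hε]; linarith
    nlinarith
  have hsub : {ω | ¬ SpikedWigner.GoodOutcome (lam • Matrix.vecMulVec v v + W ω) lam σ (ε₀ / 2)
      (1134 * Real.sqrt (ν : ℝ) * Real.log n ^ (5 / 2 : ℝ))} ⊆
      {ω | ¬ SpikedWigner.TameNoise (W ω) v σ ν (Real.log n)} := fun ω hω htame =>
    hω (htame.goodOutcome (hW.isSymm ω) ν.2 hε hε1 hC hv hlam hlν hgap hL hnL)
  refine (MeasureTheory.measure_mono hsub).trans ?_
  rcases eq_or_ne ν 0 with rfl | hν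
  · rw [hW.measure_not_tame_of_zero]
    exact zero_le
  · refine (hW.measure_not_tame_of_pos (pos_iff_ne_zero.2 hν) hn (SpikedWigner.nrm_eq_one hv)
      hL1).trans ?_
    exact ENNReal.ofReal_le_ofReal (SpikedWigner.failure_bound_le hn hL1 hnL)
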